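/- Let $L$ be even and let $\mathcal H=(\mathbb C^2)^{\otimes L}$ be the Hilbert space of a ring of $L$ spins $1/2$, with spin operators $S^{(\nu)}_\alpha$ ($\nu=1,2,3$), i.e. the spin matrices $S^{(1)}=\frac12\begin{pmatrix}0&1\\1&0\end{pmatrix}$, $S^{(2)}=\frac12\begin{pmatrix}0&-i\\i&0\end{pmatrix}$, $S^{(3)}=\frac12\begin{pmatrix}1&0\\0&-1\end{pmatrix}$ acting on the $\alpha$-th tensor factor. Let $$H=\sum_{\alpha=1}^{L}\Big(\tfrac14\mathbb 1-\sum_{\nu=1}^3 S^{(\nu)}_\alpha S^{(\nu)}_{\alpha+1}\Big)\quad(\text{site } L+1 \text{ is site } 1),\qquad \mathcal C=\sum_{\nu=1}^3\Big(\sum_{\alpha=1}^L S^{(\nu)}_\alpha\Big)^2$$ be the Heisenberg ferromagnetic Hamiltonian on the ring and the Casimir operator. Let $\mathcal H^{(0)}=\{\psi\in\mathcal H:\mathcal C\psi=0\}$ be the spin singlet sector, $$E_{\min}(0;L)=\min\Big\{\frac{\langle\psi,H\psi\rangle}{\|\psi\|^2}:\ \psi\in\mathcal H^{(0)},\ \psi\ne0\Big\},$$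 and let $\Theta_L$ be a ground state in the singlet sector: a nonzero vector $\Theta_L\in\mathcal H^{(0)}$ with $H\Theta_L=E_{\min}(0;L)\,\Theta_L$. Suppose that $A$ is an operator on $\mathcal H$ and that there is a unitary operator $U$ on $\mathcal H$ with $$A^*=U^*AU,\qquad H=U^*HU,\qquad \mathcal C=U^*\,\mathcal C\,U .$$ Then $$\big\langle\Theta_L,\ A^*\big(H-E_{\min}(0;L)\big)A\,\Theta_L\big\rangle=\tfrac12\,\big\langle\Theta_L,\ [A^*,[H,A]]\,\Theta_L\big\rangle .$$ -/

import Mathlib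

open scoped Matrix

noncomputable section

namespace SpinRing

/-- The Hilbert space `ℂ² ⊗ ⋯ ⊗ ℂ²` (`L` factors), in the orthonormal basis of product vectors
`Ψ_{σ 0} ⊗ ⋯ ⊗ Ψ_{σ (L-1)}`, where `σ α = 0` is spin up (`+1/2`) and `σ α = 1` is spin down
(`-1/2`) at site `α`. -/
abbrev HilbertSpace (L : ℕ) : Type := EuclideanSpace ℂ (Fin L → Fin 2)

/-- Operators on the Hilbert space; `star` is the adjoint and `*` is composition. -/
abbrev Op (L : ℕ) : Type := HilbertSpace L →L[ℂ] HilbertSpace L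

/-- The three spin-1/2 matrices `S⁽¹⁾`, `S⁽²⁾`, `S⁽³⁾` on `ℂ²` (`ν = 0, 1, 2`). -/
def spinMatrix : Fin 3 → Matrix (Fin 2) (Fin 2) ℂ :=
  ![!![0, 1 / 2; 1 / 2, 0],
    !![0, -Complex.I / 2; Complex.I / 2, 0],
    !![1 / 2, 0; 0, -1 / 2]]

/-- `1 ⊗ ⋯ ⊗ 1 ⊗ M ⊗ 1 ⊗ ⋯ ⊗ 1`, with the one-site matrix `M` at position `α`. -/
def siteOp (L : ℕ) (α : Fin L) (M : Matrix (Fin 2) (Fin 2) ℂ) : Op L :=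
  Matrix.toEuclideanCLM (n := Fin L → Fin 2) (𝕜 := ℂ)
    (Matrix.of fun σ τ => if ∀ β, β ≠ α → σ β = τ β then M (σ α) (τ α) else 0)

/-- The localized spin operator `S_α⁽ᵛ⁾`. -/
def spinOp (L : ℕ) (ν : Fin 3) (α : Fin L) : Op L := siteOp L α (spinMatrix ν)

/-- The interaction `h_{α,β} = 1/4 - S_α⁽¹⁾ S_β⁽¹⁾ - S_α⁽²⁾ S_β⁽²⁾ - S_α⁽³⁾ S_β⁽³⁾`. -/
def bondOp (L : ℕ) (α β : Fin L) : Op L :=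
  (1 / 4 : ℂ) • (1 : Op L) - ∑ ν : Fin 3, spinOp L ν α * spinOp L ν β

/-- The Heisenberg ferromagnet on the ring; `finRotate L α` is `α + 1` modulo `L`. -/
def hamiltonian (L : ℕ) : Op L := ∑ α : Fin L, bondOp L α (finRotate L α)

/-- The total spin operator `S_tot⁽ᵛ⁾`. -/
def totalSpin (L : ℕ) (ν : Fin 3) : Op L := ∑ α : Fin L, spinOp L ν α

/-- The Casimir operator. -/
def casimir (L : ℕ) : Op L := ∑ ν : Fin 3, totalSpin L ν ^ 2

/-- The total-spin-`S` subspace `{ψ | C ψ = S (S + 1) ψ}`. -/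
def spinSector (L S : ℕ) : Submodule ℂ (HilbertSpace L) :=
  Module.End.eigenspace (casimir L : HilbertSpace L →ₗ[ℂ] HilbertSpace L) ((S : ℂ) * (S + 1))

/-- `E_min(S; L)`: the minimum of the Rayleigh quotient of the Hamiltonian (real-valued, as the
Hamiltonian is self-adjoint) over the nonzero vectors of total spin `S`. -/
def energyMin (S L : ℕ) : ℝ :=
  sInf {r : ℝ | ∃ ψ ∈ spinSector L S, ψ ≠ 0 ∧
    r = (inner ℂ ψ (hamiltonian L ψ)).re / ‖ψ‖ ^ 2}

/-- `Θ` is a lowest-energy vector of the singlet (total spin `0`) sector. -/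
structure IsSingletGroundState (L : ℕ) (Θ : HilbertSpace L) : Prop where
  ne_zero : Θ ≠ 0
  mem_sector : Θ ∈ spinSector L 0
  eigen : hamiltonian L Θ = (energyMin 0 L : ℂ) • Θ

end SpinRing

end

/-!
The singlet ground state `Θ` is nondegenerate (`singletGroundState_unique`). As `U` commutes with
`H` and with the Casimir operator, `U Θ` is again a singlet of the lowest energy, so `U Θ = z Θ`
with `|z| = 1`. With `B = H - E_min` and `B Θ = 0`, the expectation in `Θ` of the double commutator
is that of `A* B A + A B A*`, and `A B A* = U* (A* B A) U`; hence both terms contribute equally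
(`inner_eq_half_inner_doubleCommutator`).

Nondegeneracy is a Perron–Frobenius argument in valence bond states. On two different sites the
interaction is `(1 - P) / 2` with `P` the exchange of the two spins. Let `L = 2 n`, and for a
permutation `σ` of the `n` dimers `{2 k, 2 k + 1}` let the left site of each dimer `k` be in a
singlet with the right site of the dimer `σ k`. The interaction along a bond of the ring either
fixes this state or reconnects two of its valence bonds, with the factor `1 / 2`. A reconnection
multiplies `σ` by a transposition, so the sign of `σ`, included in `valenceBond`, turns this factor
into `-1 / 2`, and the operator `(2 n + 1) - H` has nonnegative coefficients
(`sub_hamiltonian_valenceBond`). On the permutations reachable from the identity its matrix is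
irreducible, because reconnecting along all dimers leads back to the identity. The valence bond
states are not orthogonal, and their linear independence is not proved; the abstract statement
`exists_smul_eq_of_irreducible` needs two properties in its place.

* The reachable valence bond states span the singlets (`eq_zero_of_inner_valenceBond`). The
  singlets orthogonal to all of them are invariant under the interactions. Among those with the
  first `j` dimers in singlets, the interaction of the next dimer vanishes by descending induction;
  the Temperley–Lieb relation carries this over to all bonds to the right, so these vectors are
  symmetric in the remaining sites, and their Casimir eigenvalue is not zero unless they vanish
  (`eq_zero_of_symmetric`).
* No combination of them with positive coefficients vanishes. Reachable valence bonds do not cross,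
  and the only noncrossing configuration with a component along `↑⋯↑↓⋯↓` is the nested one
  (`Noncrossing.eq_revPerm`), which is reachable as its state is a singlet (`reachable_revPerm`).
-/

namespace SpinRing

/-! ### Matrix elements of the interaction -/

theorem siteOp_apply {L : ℕ} (α : Fin L) (M : Matrix (Fin 2) (Fin 2) ℂ) (v : HilbertSpace L)
    (s : Fin L → Fin 2) :
    siteOp L α M v s = ∑ x : Fin 2, M (s α) x * v (Function.update s α x) := by
  have h : siteOp L α M v s = ∑ τ : Fin L → Fin 2,
      (if ∀ β, β ≠ α → s β = τ β then M (s α) (τ α) else 0) * v τ := by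
    rw [siteOp, Matrix.ofLp_toEuclideanCLM]
    rfl
  rw [h]
  symm
  refine Finset.sum_of_injOn (fun x => Function.update s α x) ?_ ?_ ?_ ?_
  · exact (Function.update_injective s α).injOn
  · intro x _
    simp
  · intro τ _ hτ
    have : ¬ ∀ β, β ≠ α → s β = τ β := by
      intro hst
      refine hτ ⟨τ α, by simp, ?_⟩
      ext1 β
      by_cases hβ : β = α
      · subst hβ; simp
      · simp [hβ, hst β hβ]
    simp [this]
  · intro x _
    have : ∀ β, β ≠ α → s β = Function.update s α x β := fun β hβ => by simp [hβ]
    rw [if_pos this]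
    simp

theorem spinOp_mul_apply {L : ℕ} (ν : Fin 3) (α β : Fin L) (v : HilbertSpace L)
    (s : Fin L → Fin 2) :
    (spinOp L ν α * spinOp L ν β) v s = ∑ x : Fin 2, ∑ y : Fin 2,
      spinMatrix ν (s α) x * (spinMatrix ν (Function.update s α x β) y *
        v (Function.update (Function.update s α x) β y)) := by
  simp only [spinOp, _root_.mul_apply_eq_comp]
  rw [siteOp_apply]
  simp only [siteOp_apply, Finset.mul_sum]

theorem bondOp_apply {L : ℕ} (α β : Fin L) (v : HilbertSpace L) (s : Fin L → Fin 2) :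
    bondOp L α β v s = 1 / 4 * v s - ∑ ν, (spinOp L ν α * spinOp L ν β) v s := by
  simp [bondOp, Fin.sum_univ_three]

theorem comp_swap_eq_update {L : ℕ} {X : Type*} (α β : Fin L) (s : Fin L → X) :
    s ∘ Equiv.swap α β = Function.update (Function.update s α (s β)) β (s α) := by
  ext1 γ
  by_cases h1 : γ = β
  · subst h1; simp
  · by_cases h2 : γ = α
    · subst h2; simp [h1]
    · simp [h1, h2, Equiv.swap_apply_of_ne_of_ne h2 h1]

/-- On two different sites the interaction is half the difference of the identity and of the
exchange of the two spins; it is the orthogonal projection onto the singlet of the two sites. -/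
theorem bondOp_apply_of_ne {L : ℕ} {α β : Fin L} (hαβ : α ≠ β) (v : HilbertSpace L)
    (s : Fin L → Fin 2) :
    bondOp L α β v s = (v s - v (s ∘ Equiv.swap α β)) / 2 := by
  rw [bondOp_apply, comp_swap_eq_update]
  simp only [spinOp_mul_apply, Function.update_of_ne hαβ.symm]
  have h0 : v s = v (Function.update (Function.update s α (s α)) β (s β)) := by simp
  rw [h0]
  generalize hF : (fun x y => v (Function.update (Function.update s α x) β y)) = F
  have hF' : ∀ x y, v (Function.update (Function.update s α x) β y) = F x y := by
    intro x y; rw [← hF]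
  simp only [hF']
  generalize s α = p
  generalize s β = q
  have hI : Complex.I * Complex.I = -1 := Complex.I_mul_I
  fin_cases p <;> fin_cases q <;>
    simp [Fin.sum_univ_three, Fin.sum_univ_two, spinMatrix] <;>
    ring_nf <;> simp only [Complex.I_sq] <;> ring

theorem bondOp_self_apply {L : ℕ} (α : Fin L) (v : HilbertSpace L) :
    bondOp L α α v = (-1 / 2 : ℂ) • v := by
  ext1 s
  rw [bondOp_apply]
  simp only [spinOp_mul_apply, Function.update_self, Function.update_idem]
  have h0 : v s = v (Function.update s α (s α)) := by simp
  rw [PiLp.smul_apply, h0]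
  generalize hF : (fun x => v (Function.update s α x)) = F
  have hF' : ∀ x, v (Function.update s α x) = F x := by
    intro x; rw [← hF]
  simp only [hF']
  generalize s α = p
  fin_cases p <;>
    simp [Fin.sum_univ_three, Fin.sum_univ_two, spinMatrix] <;>
    ring_nf <;> simp only [Complex.I_sq] <;> ring

theorem casimir_apply {L : ℕ} (v : HilbertSpace L) :
    casimir L v = ∑ α : Fin L, ∑ β : Fin L, ((1 / 4 : ℂ) • v - bondOp L α β v) := by
  have h : ∀ α β : Fin L, (1 / 4 : ℂ) • v - bondOp L α β v =
      ∑ ν : Fin 3, (spinOp L ν α * spinOp L ν β) v := by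
    intro α β
    simp [bondOp]
  have h2 : ∀ ν, totalSpin L ν ^ 2 =
      ∑ α : Fin L, ∑ β : Fin L, spinOp L ν α * spinOp L ν β := by
    intro ν
    rw [pow_two, totalSpin, Finset.sum_mul_sum]
  simp only [h, casimir, h2, sum_apply]
  rw [Finset.sum_comm]
  refine Finset.sum_congr rfl fun α _ => ?_
  rw [Finset.sum_comm]

theorem bondOp_comm {L : ℕ} (α β : Fin L) : bondOp L α β = bondOp L β α := by
  by_cases h : α = β
  · rw [h]
  · ext v s
    rw [bondOp_apply_of_ne h, bondOp_apply_of_ne (Ne.symm h), Equiv.swap_comm]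

/-! ### Algebra of the exchange operators -/

theorem bondOp_eq_self_iff {L : ℕ} {α β : Fin L} (hαβ : α ≠ β) (v : HilbertSpace L) :
    bondOp L α β v = v ↔ ∀ s, v (s ∘ Equiv.swap α β) = -v s := by
  constructor
  · intro h s
    have := congrArg (fun w : HilbertSpace L => w s) h
    simp only [bondOp_apply_of_ne hαβ] at this
    linear_combination -2 * this
  · intro h
    ext1 s
    rw [bondOp_apply_of_ne hαβ, h]
    ring

theorem bondOp_eq_zero_iff {L : ℕ} {α β : Fin L} (hαβ : α ≠ β) (v : HilbertSpace L) :
    bondOp L α β v = 0 ↔ ∀ s, v (s ∘ Equiv.swap α β) = v s := by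
  constructor
  · intro h s
    have := congrArg (fun w : HilbertSpace L => w s) h
    simp only [bondOp_apply_of_ne hαβ, PiLp.zero_apply] at this
    linear_combination -2 * this
  · intro h
    ext1 s
    rw [bondOp_apply_of_ne hαβ, h]
    simp

theorem comp_swap_comp_swap_self {L : ℕ} {X : Type*} (α β : Fin L) (s : Fin L → X) :
    (s ∘ Equiv.swap α β) ∘ Equiv.swap α β = s := by
  ext1 γ; simp

theorem comp_swap_eq_self {L : ℕ} {X : Type*} {α β : Fin L} {s : Fin L → X} (h : s α = s β) :
    s ∘ Equiv.swap α β = s := by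
  rw [comp_swap_eq_update, ← h, Function.update_eq_self, h, Function.update_eq_self]

theorem bondOp_idem {L : ℕ} {α β : Fin L} (hαβ : α ≠ β) (v : HilbertSpace L) :
    bondOp L α β (bondOp L α β v) = bondOp L α β v := by
  rw [bondOp_eq_self_iff hαβ]
  intro s
  rw [bondOp_apply_of_ne hαβ, bondOp_apply_of_ne hαβ, comp_swap_comp_swap_self]
  ring

/-- A transposition can be moved past a permutation by conjugation. -/
theorem comp_swap_comp {L : ℕ} {X : Type*} (α β : Fin L) (π : Equiv.Perm (Fin L))
    (s : Fin L → X) :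
    (s ∘ Equiv.swap α β) ∘ π = (s ∘ π) ∘ Equiv.swap (π.symm α) (π.symm β) := by
  ext1 x
  have := π.injective.swap_apply (π.symm α) (π.symm β) x
  simp only [Equiv.apply_symm_apply] at this
  exact congrArg s this

theorem bondOp_commute {L : ℕ} {α β γ δ : Fin L} (hαβ : α ≠ β) (hγδ : γ ≠ δ)
    (h1 : α ≠ γ) (h2 : α ≠ δ) (h3 : β ≠ γ) (h4 : β ≠ δ) (v : HilbertSpace L) :
    bondOp L α β (bondOp L γ δ v) = bondOp L γ δ (bondOp L α β v) := by
  ext1 s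
  simp only [bondOp_apply_of_ne hαβ, bondOp_apply_of_ne hγδ]
  rw [comp_swap_comp α β]
  simp only [Equiv.symm_swap, Equiv.swap_apply_of_ne_of_ne h1 h2,
    Equiv.swap_apply_of_ne_of_ne h3 h4]
  ring

/-- If the sites `β` and `γ` form a singlet then their joint spin vanishes, so the exchanges of a
third site `α` with `β` and with `γ` add up to the identity. -/
theorem apply_swap_add_apply_swap {L : ℕ} {α β γ : Fin L} (hαβ : α ≠ β) (hαγ : α ≠ γ)
    (hβγ : β ≠ γ) {v : HilbertSpace L} (h : bondOp L β γ v = v) (s : Fin L → Fin 2) :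
    v (s ∘ Equiv.swap α β) + v (s ∘ Equiv.swap α γ) = v s := by
  rw [bondOp_eq_self_iff hβγ] at h
  have hzero : ∀ t : Fin L → Fin 2, t β = t γ → v t = 0 := by
    intro t ht
    have := h t
    rw [comp_swap_eq_self ht] at this
    linear_combination (1 / 2 : ℂ) * this
  by_cases hbc : s β = s γ
  · have h1 : s ∘ Equiv.swap α γ = (s ∘ Equiv.swap α β) ∘ Equiv.swap β γ := by
      rw [comp_swap_comp, comp_swap_eq_self hbc]
      simp [Equiv.swap_apply_of_ne_of_ne hαβ hαγ]
    rw [h1, h, hzero s hbc]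
    ring
  · have hcase : s α = s β ∨ s α = s γ := by
      generalize s α = x at *
      generalize s β = y at *
      generalize s γ = z at *
      revert x y z
      decide
    rcases hcase with h1 | h1
    · rw [comp_swap_eq_self h1, hzero (s ∘ Equiv.swap α γ), add_zero]
      simp [Equiv.swap_apply_of_ne_of_ne hαβ.symm hβγ, h1]
    · rw [comp_swap_eq_self h1, hzero (s ∘ Equiv.swap α β), zero_add]
      simp [Equiv.swap_apply_of_ne_of_ne hαγ.symm hβγ.symm, h1]

theorem bondOp_add_bondOp {L : ℕ} {α β : Fin L} (hαβ : α ≠ β) {v : HilbertSpace L}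
    (h : bondOp L α β v = v) (γ : Fin L) :
    bondOp L α γ v + bondOp L β γ v = (1 / 2 : ℂ) • v := by
  by_cases h1 : γ = α
  · subst h1
    rw [bondOp_self_apply, bondOp_comm, h]
    module
  by_cases h2 : γ = β
  · subst h2
    rw [bondOp_self_apply, h]
    module
  ext1 s
  rw [PiLp.add_apply, PiLp.smul_apply, bondOp_apply_of_ne (Ne.symm h1),
    bondOp_apply_of_ne (Ne.symm h2), Equiv.swap_comm α γ, Equiv.swap_comm β γ, smul_eq_mul,
    ← apply_swap_add_apply_swap h1 h2 hαβ h s]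
  ring

/-- The Temperley–Lieb relation between two bonds with a common site. -/
theorem bondOp_temperleyLieb {L : ℕ} {α β γ : Fin L} (hαβ : α ≠ β) (hαγ : α ≠ γ)
    (hβγ : β ≠ γ) (v : HilbertSpace L) :
    bondOp L β γ (bondOp L α β (bondOp L β γ v)) = (1 / 4 : ℂ) • bondOp L β γ v := by
  have h := bondOp_idem hβγ v
  generalize bondOp L β γ v = w at h
  ext1 s
  have h1 := apply_swap_add_apply_swap hαβ hαγ hβγ h s
  rw [bondOp_eq_self_iff hβγ] at h
  rw [PiLp.smul_apply, bondOp_apply_of_ne hβγ, bondOp_apply_of_ne hαβ, bondOp_apply_of_ne hαβ,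
    h, smul_eq_mul]
  have h2 : (s ∘ Equiv.swap β γ) ∘ Equiv.swap α β = (s ∘ Equiv.swap α γ) ∘ Equiv.swap β γ := by
    rw [comp_swap_comp α γ]
    simp [Equiv.swap_apply_of_ne_of_ne hαβ hαγ]
  rw [h2, h, ← h1]
  ring

/-- Invariance under two exchanges with a common site implies invariance under the third. -/
theorem bondOp_eq_zero_trans {L : ℕ} {α β γ : Fin L} (hαβ : α ≠ β) (hαγ : α ≠ γ)
    (hβγ : β ≠ γ) {v : HilbertSpace L} (h1 : bondOp L α β v = 0) (h2 : bondOp L β γ v = 0) :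
    bondOp L α γ v = 0 := by
  rw [bondOp_eq_zero_iff hαβ] at h1
  rw [bondOp_eq_zero_iff hβγ] at h2
  rw [bondOp_eq_zero_iff hαγ]
  intro s
  have h3 : (s ∘ Equiv.swap α γ) ∘ Equiv.swap β γ = (s ∘ Equiv.swap β γ) ∘ Equiv.swap α β := by
    rw [comp_swap_comp α γ]
    simp [Equiv.swap_apply_of_ne_of_ne hαβ hαγ]
  rw [← h2, h3, h1, h2]

/-- The permutation of the sites, as a linear map. -/
def sitePerm {L : ℕ} (π : Equiv.Perm (Fin L)) : HilbertSpace L →ₗ[ℂ] HilbertSpace L where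
  toFun v := WithLp.toLp 2 fun s => v (s ∘ π)
  map_add' _ _ := rfl
  map_smul' _ _ := rfl

theorem sitePerm_apply {L : ℕ} (π : Equiv.Perm (Fin L)) (v : HilbertSpace L)
    (s : Fin L → Fin 2) : sitePerm π v s = v (s ∘ π) := rfl

theorem bondOp_eq_sitePerm {L : ℕ} {α β : Fin L} (hαβ : α ≠ β) (v : HilbertSpace L) :
    bondOp L α β v = (1 / 2 : ℂ) • (v - sitePerm (Equiv.swap α β) v) := by
  ext1 s
  rw [bondOp_apply_of_ne hαβ, PiLp.smul_apply, PiLp.sub_apply, sitePerm_apply, smul_eq_mul]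
  ring

theorem bondOp_sitePerm {L : ℕ} (α β : Fin L) (π : Equiv.Perm (Fin L)) (v : HilbertSpace L) :
    bondOp L α β (sitePerm π v) = sitePerm π (bondOp L (π.symm α) (π.symm β) v) := by
  by_cases h : α = β
  · subst h
    rw [bondOp_self_apply, bondOp_self_apply, map_smul]
  · ext1 s
    rw [bondOp_apply_of_ne h, sitePerm_apply, sitePerm_apply, sitePerm_apply,
      bondOp_apply_of_ne (by simpa using h), comp_swap_comp]

theorem casimir_sitePerm {L : ℕ} (π : Equiv.Perm (Fin L)) (v : HilbertSpace L) :
    casimir L (sitePerm π v) = sitePerm π (casimir L v) := by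
  rw [casimir_apply, casimir_apply, map_sum, ← Equiv.sum_comp π]
  refine Finset.sum_congr rfl fun α _ => ?_
  rw [map_sum, ← Equiv.sum_comp π]
  refine Finset.sum_congr rfl fun β _ => ?_
  rw [bondOp_sitePerm, map_sub, map_smul, Equiv.symm_apply_apply, Equiv.symm_apply_apply]

theorem casimir_bondOp {L : ℕ} {α β : Fin L} (hαβ : α ≠ β) (v : HilbertSpace L) :
    casimir L (bondOp L α β v) = bondOp L α β (casimir L v) := by
  rw [bondOp_eq_sitePerm hαβ, bondOp_eq_sitePerm hαβ, map_smul, map_sub, casimir_sitePerm]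

theorem inner_bondOp_left {L : ℕ} (α β : Fin L) (v w : HilbertSpace L) :
    inner ℂ (bondOp L α β v) w = inner ℂ v (bondOp L α β w) := by
  by_cases h : α = β
  · subst h
    rw [bondOp_self_apply, bondOp_self_apply, inner_smul_left, inner_smul_right]
    simp [Complex.conj_ofNat]
  · have key : inner ℂ (sitePerm (Equiv.swap α β) v) w =
        inner ℂ v (sitePerm (Equiv.swap α β) w) := by
      simp only [PiLp.inner_apply, sitePerm_apply]
      rw [← Equiv.sum_comp (Equiv.arrowCongr (Equiv.swap α β) (Equiv.refl (Fin 2)))]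
      refine Finset.sum_congr rfl fun s _ => ?_
      have h1 : (Equiv.arrowCongr (Equiv.swap α β) (Equiv.refl (Fin 2))) s =
          s ∘ Equiv.swap α β := by
        ext1; simp
      rw [h1, comp_swap_comp_swap_self]
    rw [bondOp_eq_sitePerm h, bondOp_eq_sitePerm h, inner_smul_left, inner_smul_right,
      inner_sub_left, inner_sub_right, key]
    simp [Complex.conj_ofNat]

theorem mem_singletSector_iff {L : ℕ} {v : HilbertSpace L} :
    v ∈ spinSector L 0 ↔ casimir L v = 0 := by
  simp [spinSector]

theorem bondOp_mem_singletSector {L : ℕ} {α β : Fin L} (hαβ : α ≠ β) {v : HilbertSpace L}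
    (hv : v ∈ spinSector L 0) : bondOp L α β v ∈ spinSector L 0 := by
  rw [mem_singletSector_iff] at hv ⊢
  rw [casimir_bondOp hαβ, hv, map_zero]

/-! ### Dimerized singlets -/

/-- The left site of the `k`-th dimer of the ring. -/
def leftSite {n : ℕ} (k : Fin n) : Fin (n * 2) := ⟨2 * k, by omega⟩

/-- The right site of the `k`-th dimer of the ring. -/
def rightSite {n : ℕ} (k : Fin n) : Fin (n * 2) := ⟨2 * k + 1, by omega⟩

theorem leftSite_ne_rightSite {n : ℕ} (k l : Fin n) : leftSite k ≠ rightSite l := by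
  simp only [leftSite, rightSite, ne_eq, Fin.mk.injEq]; omega

theorem leftSite_injective {n : ℕ} : Function.Injective (leftSite (n := n)) := by
  intro k l h
  simp only [leftSite, Fin.mk.injEq] at h
  omega

theorem rightSite_injective {n : ℕ} : Function.Injective (rightSite (n := n)) := by
  intro k l h
  simp only [rightSite, Fin.mk.injEq] at h
  omega

theorem sum_sites {n : ℕ} {M : Type*} [AddCommMonoid M] (f : Fin (n * 2) → M) :
    ∑ α, f α = ∑ k : Fin n, (f (leftSite k) + f (rightSite k)) := by
  rw [← finProdFinEquiv.sum_comp, Fintype.sum_prod_type]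
  refine Finset.sum_congr rfl fun k _ => ?_
  rw [Fin.sum_univ_two]
  congr 2 <;> ext <;> simp [leftSite, rightSite, finProdFinEquiv, add_comm]

/-- If the sites fall into two classes paired by `σ`, all pairs being in a singlet, then the total
spin vanishes. -/
theorem casimir_eq_zero_of_dimers {n : ℕ} (σ : Equiv.Perm (Fin n)) {v : HilbertSpace (n * 2)}
    (h : ∀ k, bondOp (n * 2) (leftSite k) (rightSite (σ k)) v = v) : casimir (n * 2) v = 0 := by
  rw [casimir_apply, sum_sites, Finset.sum_add_distrib, ← Equiv.sum_comp σ
    (fun k => ∑ β, ((1 / 4 : ℂ) • v - bondOp (n * 2) (rightSite k) β v)),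
    ← Finset.sum_add_distrib]
  refine Finset.sum_eq_zero fun k _ => ?_
  rw [← Finset.sum_add_distrib]
  refine Finset.sum_eq_zero fun β _ => ?_
  have := bondOp_add_bondOp (leftSite_ne_rightSite k (σ k)) (h k) β
  rw [eq_sub_of_add_eq this]
  module

/-- If the first `j` dimers are in singlets and the state is symmetric in the remaining
`m = 2 (n - j)` sites, then the total spin is `m / 2`; so a singlet of this form vanishes. -/
theorem eq_zero_of_symmetric {n j : ℕ} (hj : j < n) {v : HilbertSpace (n * 2)}
    (hv : casimir (n * 2) v = 0)
    (hdim : ∀ k : Fin n, (k : ℕ) < j → bondOp (n * 2) (leftSite k) (rightSite k) v = v)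
    (hsym : ∀ α β : Fin (n * 2), 2 * j ≤ α → 2 * j ≤ β → α ≠ β → bondOp (n * 2) α β v = 0) :
    v = 0 := by
  set Q : Fin (n * 2) → Fin (n * 2) → HilbertSpace (n * 2) :=
    fun α β => (1 / 4 : ℂ) • v - bondOp (n * 2) α β v with hQ
  have hQ1 : ∀ k : Fin n, (k : ℕ) < j → ∀ β, Q (leftSite k) β + Q (rightSite k) β = 0 := by
    intro k hk β
    have := bondOp_add_bondOp (leftSite_ne_rightSite k k) (hdim k hk) β
    simp only [hQ]
    rw [eq_sub_of_add_eq this]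
    module
  have hQc : ∀ α β, Q α β = Q β α := fun α β => by simp only [hQ]; rw [bondOp_comm]
  have hQs : ∀ α β : Fin (n * 2), 2 * j ≤ α → 2 * j ≤ β → α ≠ β → Q α β = (1 / 4 : ℂ) • v := by
    intro α β h1 h2 h3
    simp only [hQ, hsym α β h1 h2 h3, sub_zero]
  have hQd : ∀ α, Q α α = (3 / 4 : ℂ) • v := by
    intro α
    simp only [hQ, bondOp_self_apply]
    module
  have hG : ∀ k l : Fin n, Q (leftSite k) (leftSite l) + Q (leftSite k) (rightSite l) +
      (Q (rightSite k) (leftSite l) + Q (rightSite k) (rightSite l)) =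
      ((if j ≤ (k : ℕ) ∧ j ≤ (l : ℕ) then (if k = l then 2 else 1) else 0 : ℕ) : ℂ) • v := by
    intro k l
    split_ifs with h1 h2
    · subst h2
      rw [hQd, hQd, hQc (rightSite k),
        hQs _ _ (by simp [leftSite]; omega) (by simp [rightSite]; omega)
          (leftSite_ne_rightSite k k)]
      push_cast
      module
    · rw [hQs _ _ (by simp [leftSite]; omega) (by simp [leftSite]; omega)
        (leftSite_injective.ne h2), hQs _ _ (by simp [leftSite]; omega)
        (by simp [rightSite]; omega) (leftSite_ne_rightSite k l),
        hQs _ _ (by simp [rightSite]; omega) (by simp [leftSite]; omega)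
        (leftSite_ne_rightSite l k).symm, hQs _ _ (by simp [rightSite]; omega)
        (by simp [rightSite]; omega) (rightSite_injective.ne h2)]
      push_cast
      module
    · rw [Nat.cast_zero, zero_smul]
      rcases not_and_or.1 h1 with h | h
      · have e1 := hQ1 k (by omega) (leftSite l)
        have e2 := hQ1 k (by omega) (rightSite l)
        rw [eq_neg_of_add_eq_zero_left e1, eq_neg_of_add_eq_zero_left e2]
        abel
      · have e1 := hQ1 l (by omega) (leftSite k)
        have e2 := hQ1 l (by omega) (rightSite k)
        rw [hQc (leftSite k), hQc (leftSite k), hQc (rightSite k), hQc (rightSite k), e1, e2,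
          add_zero]
  have hC : casimir (n * 2) v = ((∑ k : Fin n, ∑ l : Fin n,
      (if j ≤ (k : ℕ) ∧ j ≤ (l : ℕ) then (if k = l then 2 else 1) else 0) : ℕ) : ℂ) • v := by
    rw [casimir_apply, sum_sites]
    push_cast [Finset.sum_smul]
    refine Finset.sum_congr rfl fun k _ => ?_
    rw [sum_sites, sum_sites, ← Finset.sum_add_distrib]
    refine Finset.sum_congr rfl fun l _ => ?_
    have := hG k l
    push_cast at this
    exact this
  rw [hv] at hC
  refine (smul_eq_zero.1 hC.symm).resolve_left ?_
  rw [Nat.cast_eq_zero]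
  intro h0
  have h1 := Finset.sum_eq_zero_iff.1 h0 ⟨j, hj⟩ (Finset.mem_univ _)
  have h2 := Finset.sum_eq_zero_iff.1 h1 ⟨j, hj⟩ (Finset.mem_univ _)
  simp at h2

/-- Descent along the dimers. A space of singlets that is invariant under all nearest-neighbour
interactions of the open chain, and has no nonzero vector with all dimers in singlets, is
trivial. -/
theorem eq_zero_of_invariant {n : ℕ} (N : Submodule ℂ (HilbertSpace (n * 2)))
    (hN : ∀ α β : Fin (n * 2), (β : ℕ) = α + 1 → ∀ v ∈ N, bondOp (n * 2) α β v ∈ N)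
    (hsing : ∀ v ∈ N, casimir (n * 2) v = 0)
    (hfull : ∀ v ∈ N, (∀ k, bondOp (n * 2) (leftSite k) (rightSite k) v = v) → v = 0)
    {v : HilbertSpace (n * 2)} (hv : v ∈ N) : v = 0 := by
  suffices H : ∀ m j : ℕ, j + m = n → ∀ v ∈ N,
      (∀ k : Fin n, (k : ℕ) < j → bondOp (n * 2) (leftSite k) (rightSite k) v = v) → v = 0 from
    H n 0 (by omega) v hv (by simp)
  intro m
  induction m with
  | zero =>
    intro j hj v hv hd
    exact hfull v hv fun k => hd k (by omega)
  | succ m ih =>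
    intro j hj v hv hd
    have hne : ∀ α β : Fin (n * 2), (β : ℕ) = α + 1 → α ≠ β := by
      intro α β h h'
      rw [h'] at h; omega
    -- The dimerized vectors stay dimerized under the interactions to the right of the dimers.
    have hpres : ∀ α β : Fin (n * 2), (β : ℕ) = α + 1 → 2 * j ≤ α → ∀ w ∈ N,
        (∀ k : Fin n, (k : ℕ) < j → bondOp (n * 2) (leftSite k) (rightSite k) w = w) →
        ∀ k : Fin n, (k : ℕ) < j → bondOp (n * 2) (leftSite k) (rightSite k)
          (bondOp (n * 2) α β w) = bondOp (n * 2) α β w := by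
      intro α β hαβ hα w _ hw k hk
      rw [bondOp_commute (leftSite_ne_rightSite k k) (hne α β hαβ), hw k hk] <;>
      · intro h
        have := congrArg Fin.val h
        simp [leftSite, rightSite] at this
        omega
    have hadj : ∀ i, 2 * j ≤ i → ∀ α β : Fin (n * 2), (α : ℕ) = i → (β : ℕ) = i + 1 → ∀ w ∈ N,
        (∀ k : Fin n, (k : ℕ) < j → bondOp (n * 2) (leftSite k) (rightSite k) w = w) →
        bondOp (n * 2) α β w = 0 := by
      intro i hi
      induction i, hi using Nat.le_induction with
      | base =>
        intro α β hα hβ w hw hwd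
        have hα' : α = leftSite ⟨j, by omega⟩ := Fin.ext hα
        have hβ' : β = rightSite ⟨j, by omega⟩ := Fin.ext hβ
        refine ih (j + 1) (by omega) _ (hN α β (by omega) w hw) fun k hk => ?_
        by_cases hkj : (k : ℕ) < j
        · exact hpres α β (by omega) (by omega) w hw hwd k hkj
        · have : k = ⟨j, by omega⟩ := Fin.ext (by simp; omega)
          rw [hα', hβ', this]
          exact bondOp_idem (leftSite_ne_rightSite _ _) w
      | succ i hi ihi =>
        intro α β hα hβ w hw hwd
        have h1 := ihi ⟨i, by omega⟩ α rfl hα _ (hN α β (by omega) w hw)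
          (hpres α β (by omega) (by omega) w hw hwd)
        have h2 := bondOp_temperleyLieb (α := ⟨i, by omega⟩) (β := α) (γ := β)
          (hne _ _ hα) (fun h => by have := congrArg Fin.val h; simp at this; omega)
          (hne α β (by omega)) w
        rw [h1, map_zero] at h2
        exact (smul_eq_zero.1 h2.symm).resolve_left (by norm_num)
    have hall : ∀ d : ℕ, ∀ α β : Fin (n * 2), 2 * j ≤ α → (β : ℕ) = α + d + 1 →
        bondOp (n * 2) α β v = 0 := by
      intro d
      induction d with
      | zero => intro α β hα hβ; exact hadj α hα α β rfl (by omega) v hv hd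
      | succ d ihd =>
        intro α β hα hβ
        have h1 := ihd α ⟨α + d + 1, by omega⟩ hα rfl
        have h2 := hadj (α + d + 1) (by omega) ⟨α + d + 1, by omega⟩ β rfl (by omega) v hv hd
        exact bondOp_eq_zero_trans (Fin.ne_of_val_ne (by dsimp only; omega))
          (Fin.ne_of_val_ne (by omega)) (Fin.ne_of_val_ne (by dsimp only; omega)) h1 h2
    refine eq_zero_of_symmetric (by omega) (hsing v hv) hd fun α β hα hβ hαβ => ?_
    rcases lt_or_gt_of_ne (Fin.val_ne_of_ne hαβ) with h | h
    · exact hall (β - α - 1) α β hα (by omega)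
    · rw [bondOp_comm]
      exact hall (α - β - 1) β α hβ (by omega)

/-! ### Valence bond states -/

/-- The amplitude of the two-site singlet `↑↓ - ↓↑`. -/
def singletAmp (x y : Fin 2) : ℂ := if x = y then 0 else if x = 0 then 1 else -1

theorem singletAmp_swap (x y : Fin 2) : singletAmp y x = -singletAmp x y := by
  fin_cases x <;> fin_cases y <;> simp [singletAmp]

/-- The Plücker relation, which resolves an exchange of two spins into valence bonds. -/
theorem singletAmp_pluecker (x y z w : Fin 2) :
    singletAmp x y * singletAmp z w - singletAmp w y * singletAmp z x =
      singletAmp x w * singletAmp z y := by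
  fin_cases x <;> fin_cases y <;> fin_cases z <;> fin_cases w <;> simp [singletAmp]

/-- The valence bond state of the permutation `σ`: the left site of the dimer `k` is in a singlet
with the right site of the dimer `σ k`. The sign of `σ` is included as a factor; it makes all
off-diagonal coefficients of the Hamiltonian in these states nonpositive. -/
def valenceBond {n : ℕ} (σ : Equiv.Perm (Fin n)) : HilbertSpace (n * 2) :=
  WithLp.toLp 2 fun s => ((Equiv.Perm.sign σ : ℤ) : ℂ) *
    ∏ k, singletAmp (s (leftSite k)) (s (rightSite (σ k)))

theorem valenceBond_apply {n : ℕ} (σ : Equiv.Perm (Fin n)) (s : Fin (n * 2) → Fin 2) :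
    valenceBond σ s = ((Equiv.Perm.sign σ : ℤ) : ℂ) *
      ∏ k, singletAmp (s (leftSite k)) (s (rightSite (σ k))) := rfl

/-- Reconnection of valence bonds: the permutation that joins `k` with `l`, and the former partner
of `l` with the former partner of `k`. -/
def surgery {n : ℕ} (σ : Equiv.Perm (Fin n)) (k l : Fin n) : Equiv.Perm (Fin n) :=
  Equiv.swap l (σ k) * σ

theorem surgery_apply_self {n : ℕ} (σ : Equiv.Perm (Fin n)) (k l : Fin n) :
    surgery σ k l k = l := by
  simp [surgery]

theorem surgery_apply_symm {n : ℕ} (σ : Equiv.Perm (Fin n)) (k l : Fin n) :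
    surgery σ k l (σ.symm l) = σ k := by
  simp [surgery]

theorem surgery_apply_of_ne {n : ℕ} (σ : Equiv.Perm (Fin n)) {k l m : Fin n}
    (h1 : m ≠ k) (h2 : σ m ≠ l) : surgery σ k l m = σ m := by
  simp only [surgery, Equiv.Perm.mul_apply]
  exact Equiv.swap_apply_of_ne_of_ne h2 (σ.injective.ne h1)

theorem surgery_of_eq {n : ℕ} {σ : Equiv.Perm (Fin n)} {k l : Fin n} (h : σ k = l) :
    surgery σ k l = σ := by
  rw [surgery, h, Equiv.swap_self]
  rfl

theorem bondOp_valenceBond_of_eq {n : ℕ} {σ : Equiv.Perm (Fin n)} {k l : Fin n} (h : σ k = l) :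
    bondOp (n * 2) (leftSite k) (rightSite l) (valenceBond σ) = valenceBond σ := by
  rw [bondOp_eq_self_iff (leftSite_ne_rightSite k l)]
  intro s
  rw [valenceBond_apply, valenceBond_apply, ← Finset.mul_prod_erase _ _ (Finset.mem_univ k),
    ← Finset.mul_prod_erase _ _ (Finset.mem_univ k)]
  have h1 : ∀ m ∈ Finset.univ.erase k,
      singletAmp ((s ∘ Equiv.swap (leftSite k) (rightSite l)) (leftSite m))
        ((s ∘ Equiv.swap (leftSite k) (rightSite l)) (rightSite (σ m))) =
      singletAmp (s (leftSite m)) (s (rightSite (σ m))) := by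
    intro m hm
    have hmk := Finset.ne_of_mem_erase hm
    simp only [Function.comp]
    rw [Equiv.swap_apply_of_ne_of_ne (leftSite_injective.ne hmk) (leftSite_ne_rightSite m l),
      Equiv.swap_apply_of_ne_of_ne (leftSite_ne_rightSite k _).symm
        (rightSite_injective.ne (h ▸ σ.injective.ne hmk))]
  rw [Finset.prod_congr rfl h1]
  simp only [Function.comp, h, Equiv.swap_apply_left, Equiv.swap_apply_right]
  rw [singletAmp_swap]
  ring

theorem bondOp_valenceBond_of_ne {n : ℕ} {σ : Equiv.Perm (Fin n)} {k l : Fin n} (h : σ k ≠ l) :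
    bondOp (n * 2) (leftSite k) (rightSite l) (valenceBond σ) =
      (-1 / 2 : ℂ) • valenceBond (surgery σ k l) := by
  have hlk := leftSite_ne_rightSite k l
  ext1 s
  rw [bondOp_apply_of_ne hlk, PiLp.smul_apply]
  simp only [valenceBond_apply]
  obtain ⟨m, rfl⟩ := σ.surjective l
  have hmk : m ≠ k := fun h' => h (by rw [h'])
  have hsign : ((Equiv.Perm.sign (surgery σ k (σ m)) : ℤ) : ℂ) =
      -((Equiv.Perm.sign σ : ℤ) : ℂ) := by
    rw [surgery, Equiv.Perm.sign_mul, Equiv.Perm.sign_swap h.symm]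
    simp
  have hprod : ∀ f : Fin n → ℂ,
      ∏ i, f i = f k * (f m * ∏ i ∈ (Finset.univ.erase k).erase m, f i) := by
    intro f
    rw [Finset.mul_prod_erase _ _ (Finset.mem_erase.2 ⟨hmk, Finset.mem_univ m⟩),
      Finset.mul_prod_erase _ _ (Finset.mem_univ k)]
  have h1 : ∀ i ∈ (Finset.univ.erase k).erase m,
      singletAmp ((s ∘ Equiv.swap (leftSite k) (rightSite (σ m))) (leftSite i))
        ((s ∘ Equiv.swap (leftSite k) (rightSite (σ m))) (rightSite (σ i))) =
      singletAmp (s (leftSite i)) (s (rightSite (σ i))) := by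
    intro i hi
    have him := Finset.ne_of_mem_erase hi
    have hik := Finset.ne_of_mem_erase (Finset.mem_of_mem_erase hi)
    simp only [Function.comp]
    rw [Equiv.swap_apply_of_ne_of_ne (leftSite_injective.ne hik) (leftSite_ne_rightSite i _),
      Equiv.swap_apply_of_ne_of_ne (leftSite_ne_rightSite k _).symm
        (rightSite_injective.ne (σ.injective.ne him))]
  have h2 : ∀ i ∈ (Finset.univ.erase k).erase m,
      singletAmp (s (leftSite i)) (s (rightSite (surgery σ k (σ m) i))) =
      singletAmp (s (leftSite i)) (s (rightSite (σ i))) := by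
    intro i hi
    have him := Finset.ne_of_mem_erase hi
    have hik := Finset.ne_of_mem_erase (Finset.mem_of_mem_erase hi)
    rw [surgery_apply_of_ne σ hik (σ.injective.ne him)]
  have h3 : surgery σ k (σ m) m = σ k := by
    simpa using surgery_apply_symm σ k (σ m)
  rw [hprod, hprod, hprod, Finset.prod_congr rfl h1, Finset.prod_congr rfl h2, hsign,
    surgery_apply_self, h3]
  simp only [Function.comp, Equiv.swap_apply_left, Equiv.swap_apply_right,
    Equiv.swap_apply_of_ne_of_ne (leftSite_injective.ne hmk) (leftSite_ne_rightSite m (σ m)),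
    Equiv.swap_apply_of_ne_of_ne (leftSite_ne_rightSite k (σ k)).symm (rightSite_injective.ne h)]
  rw [smul_eq_mul]
  have := singletAmp_pluecker (s (leftSite k)) (s (rightSite (σ k))) (s (leftSite m))
    (s (rightSite (σ m)))
  linear_combination (((Equiv.Perm.sign σ : ℤ) : ℂ) / 2 *
    ∏ i ∈ (Finset.univ.erase k).erase m, singletAmp (s (leftSite i)) (s (rightSite (σ i)))) * this

theorem casimir_valenceBond {n : ℕ} (σ : Equiv.Perm (Fin n)) :
    casimir (n * 2) (valenceBond σ) = 0 :=
  casimir_eq_zero_of_dimers σ fun _ => bondOp_valenceBond_of_eq rfl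

theorem coe_finRotate_eq_mod {m : ℕ} (i : Fin m) : (finRotate m i : ℕ) = (i + 1) % m := by
  cases m with
  | zero => exact i.elim0
  | succ m => rw [finRotate_apply, Fin.val_add]; simp

/-- The bonds of the ring: the `k`-th dimer, and the bond from the right site of the `k`-th dimer
to the left site of the next one. A bond is given by the dimer of its left-type site and the dimer
of its right-type site. -/
def ringBond {n : ℕ} : Fin n ⊕ Fin n → Fin n × Fin n
  | Sum.inl k => (k, k)
  | Sum.inr k => (finRotate n k, k)

theorem hamiltonian_eq_sum_ringBond (n : ℕ) : hamiltonian (n * 2) =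
    ∑ b : Fin n ⊕ Fin n, bondOp (n * 2) (leftSite (ringBond b).1) (rightSite (ringBond b).2) := by
  rw [hamiltonian, sum_sites, Finset.sum_add_distrib, Fintype.sum_sum_type]
  congr 1
  · refine Finset.sum_congr rfl fun k _ => ?_
    have : finRotate (n * 2) (leftSite k) = rightSite k := by
      ext
      rw [coe_finRotate_eq_mod, Nat.mod_eq_of_lt] <;> (simp [leftSite, rightSite]; try omega)
    rw [this, ringBond]
  · refine Finset.sum_congr rfl fun k _ => ?_
    have : finRotate (n * 2) (rightSite k) = leftSite (finRotate n k) := by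
      ext
      simp only [coe_finRotate_eq_mod, leftSite, rightSite]
      rw [mul_comm n 2, ← Nat.mul_mod_mul_left]
      congr 1
    rw [this, ringBond, bondOp_comm]

/-- The signed valence bond states have nonnegative coefficients under `(2 n + 1) - H`. -/
theorem sub_hamiltonian_valenceBond {n : ℕ} (σ : Equiv.Perm (Fin n)) :
    (2 * n + 1 : ℂ) • valenceBond σ - hamiltonian (n * 2) (valenceBond σ) =
      valenceBond σ + ∑ b : Fin n ⊕ Fin n, if σ (ringBond b).1 = (ringBond b).2 then 0 else
        (valenceBond σ + (1 / 2 : ℂ) • valenceBond (surgery σ (ringBond b).1 (ringBond b).2)) := by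
  have h : ∀ b : Fin n ⊕ Fin n, (if σ (ringBond b).1 = (ringBond b).2 then 0 else
      (valenceBond σ + (1 / 2 : ℂ) • valenceBond (surgery σ (ringBond b).1 (ringBond b).2))) =
      valenceBond σ - bondOp (n * 2) (leftSite (ringBond b).1) (rightSite (ringBond b).2)
        (valenceBond σ) := by
    intro b
    split_ifs with h
    · rw [bondOp_valenceBond_of_eq h, sub_self]
    · rw [bondOp_valenceBond_of_ne h]
      module
  simp only [h, Finset.sum_sub_distrib, hamiltonian_eq_sum_ringBond, sum_apply]
  simp only [Finset.sum_const, Finset.card_univ, Fintype.card_sum, Fintype.card_fin]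
  rw [← Nat.cast_smul_eq_nsmul ℂ]
  push_cast
  module

/-! ### Perron–Frobenius -/

theorem matrix_pow_nonneg {ι : Type*} [Fintype ι] [DecidableEq ι] {K : Matrix ι ι ℝ}
    (hK : ∀ i j, 0 ≤ K i j) (k : ℕ) (i j : ι) : 0 ≤ (K ^ k) i j := by
  induction k generalizing i j with
  | zero => rw [pow_zero, Matrix.one_apply]; split_ifs <;> norm_num
  | succ k ih =>
    rw [pow_succ, Matrix.mul_apply]
    exact Finset.sum_nonneg fun m _ => mul_nonneg (ih i m) (hK m j)

theorem exists_sum_pow_pos {ι : Type*} [Fintype ι] [DecidableEq ι] {K : Matrix ι ι ℝ}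
    (hK : ∀ i j, 0 ≤ K i j) (hirr : ∀ i j, ∃ k : ℕ, 0 < (K ^ k) i j) :
    ∃ N : ℕ, ∀ i j, 0 < (∑ k ∈ Finset.range N, K ^ k) i j := by
  choose f hf using hirr
  refine ⟨(Finset.univ.sup fun p : ι × ι => f p.1 p.2) + 1, fun i j => ?_⟩
  rw [Matrix.sum_apply]
  refine Finset.sum_pos' (fun k _ => matrix_pow_nonneg hK k i j) ⟨f i j, ?_, hf i j⟩
  rw [Finset.mem_range, Nat.lt_succ_iff]
  exact Finset.le_sup (f := fun p : ι × ι => f p.1 p.2) (Finset.mem_univ (i, j))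

theorem mulVec_pos_of_pos {ι : Type*} [Fintype ι] {P : Matrix ι ι ℝ}
    (hP : ∀ i j, 0 < P i j) {x : ι → ℝ} (hx : ∀ i, 0 ≤ x i) (hx0 : x ≠ 0) (i : ι) :
    0 < (P *ᵥ x) i := by
  obtain ⟨j, hj⟩ := Function.ne_iff.1 hx0
  exact Finset.sum_pos' (fun k _ => mul_nonneg (hP i k).le (hx k))
    ⟨j, Finset.mem_univ j, mul_pos (hP i j) (lt_of_le_of_ne (hx j) (Ne.symm hj))⟩

/-- Existence of the Perron vector of an irreducible nonnegative matrix. It is obtained from the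
Collatz–Wielandt principle: the largest `r` with `r x ≤ K x` for some `x` in the simplex exists by
compactness, and there equality holds, as otherwise a positive polynomial in `K` applied to `x`
would admit a larger `r`. -/
theorem exists_pos_eigenvector {ι : Type*} [Fintype ι] [DecidableEq ι] [Nonempty ι]
    {K : Matrix ι ι ℝ} (hK : ∀ i j, 0 ≤ K i j) (hirr : ∀ i j, ∃ k : ℕ, 0 < (K ^ k) i j) :
    ∃ (r : ℝ) (x : ι → ℝ), (∀ i, 0 < x i) ∧ K *ᵥ x = r • x := by
  obtain ⟨N, hP⟩ := exists_sum_pow_pos hK hirr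
  set P := ∑ k ∈ Finset.range N, K ^ k with hPdef
  have hcomm : K * P = P * K := by
    rw [hPdef, Finset.mul_sum, Finset.sum_mul]
    exact Finset.sum_congr rfl fun k _ => (Commute.self_pow K k).eq
  set R := ∑ i, ∑ j, K i j with hR
  set S : Set ((ι → ℝ) × ℝ) :=
    {p | p ∈ stdSimplex ℝ ι ×ˢ Set.Icc 0 R ∧ ∀ i, p.2 * p.1 i ≤ (K *ᵥ p.1) i} with hS
  have hScomp : IsCompact S := by
    refine ((isCompact_stdSimplex ℝ ι).prod isCompact_Icc).of_isClosed_subset ?_ fun p hp => hp.1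
    have hcl : IsClosed {p : (ι → ℝ) × ℝ | ∀ i, p.2 * p.1 i ≤ (K *ᵥ p.1) i} := by
      rw [show {p : (ι → ℝ) × ℝ | ∀ i, p.2 * p.1 i ≤ (K *ᵥ p.1) i} =
        ⋂ i, {p | p.2 * p.1 i ≤ (K *ᵥ p.1) i} by ext; simp]
      refine isClosed_iInter fun i => isClosed_le (by fun_prop) ?_
      simp only [Matrix.mulVec, dotProduct]
      fun_prop
    exact (((isCompact_stdSimplex ℝ ι).prod isCompact_Icc).isClosed).inter hcl
  have hbound : ∀ (x : ι → ℝ) (r : ℝ), x ∈ stdSimplex ℝ ι → 0 ≤ r →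
      (∀ i, r * x i ≤ (K *ᵥ x) i) → (x, r) ∈ S := by
    intro x r hx hr h
    refine ⟨⟨hx, hr, ?_⟩, h⟩
    calc r = ∑ i, r * x i := by rw [← Finset.mul_sum, hx.2, mul_one]
      _ ≤ ∑ i, (K *ᵥ x) i := Finset.sum_le_sum fun i _ => h i
      _ ≤ R := by
        refine Finset.sum_le_sum fun i _ => Finset.sum_le_sum fun j _ => ?_
        have : x j ≤ 1 := by
          rw [← hx.2]
          exact Finset.single_le_sum (fun k _ => hx.1 k) (Finset.mem_univ j)
        exact mul_le_of_le_one_right (hK i j) this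
  have hSne : S.Nonempty := by
    obtain ⟨i⟩ := ‹Nonempty ι›
    refine ⟨(Pi.single i 1, 0), hbound _ 0 (single_mem_stdSimplex ℝ i) le_rfl fun j => ?_⟩
    rw [zero_mul]
    exact Finset.sum_nonneg fun k _ => mul_nonneg (hK j k) ((single_mem_stdSimplex ℝ i).1 k)
  obtain ⟨⟨x, r⟩, hxS, hmax⟩ := hScomp.exists_isMaxOn hSne continuous_snd.continuousOn
  obtain ⟨⟨hx, hr, -⟩, hxr⟩ := hxS
  simp only at hx hr hxr
  have hx0 : x ≠ 0 := by
    rintro rfl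
    simpa using hx.2
  have hz := mulVec_pos_of_pos hP hx.1 hx0
  have heq : K *ᵥ x = r • x := by
    by_contra hne
    have hy := mulVec_pos_of_pos hP (x := K *ᵥ x - r • x)
      (fun i => by simpa using hxr i) (sub_ne_zero.2 hne)
    obtain ⟨i₀, hi₀⟩ := Finite.exists_min fun i => (P *ᵥ (K *ᵥ x - r • x)) i / (P *ᵥ x) i
    set δ := (P *ᵥ (K *ᵥ x - r • x)) i₀ / (P *ᵥ x) i₀ with hδ
    have hδpos : 0 < δ := div_pos (hy i₀) (hz i₀)
    set t := ∑ i, (P *ᵥ x) i with ht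
    have htpos : 0 < t := Finset.sum_pos (fun i _ => hz i) Finset.univ_nonempty
    have hKz : K *ᵥ (P *ᵥ x) = r • (P *ᵥ x) + P *ᵥ (K *ᵥ x - r • x) := by
      rw [Matrix.mulVec_mulVec, hcomm, Matrix.mulVec_sub, Matrix.mulVec_smul,
        Matrix.mulVec_mulVec]
      abel
    have hmem : (t⁻¹ • (P *ᵥ x), r + δ) ∈ S := by
      refine hbound _ _ ⟨fun i => ?_, ?_⟩ (by positivity) fun i => ?_
      · exact mul_nonneg (inv_nonneg.2 htpos.le) (hz i).le
      · simp only [Pi.smul_apply, smul_eq_mul]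
        rw [← Finset.mul_sum]
        exact inv_mul_cancel₀ htpos.ne'
      · rw [Matrix.mulVec_smul, hKz]
        simp only [Pi.smul_apply, smul_eq_mul, Pi.add_apply]
        have h1 : δ * (P *ᵥ x) i ≤ (P *ᵥ (K *ᵥ x - r • x)) i := by
          rw [← le_div_iff₀ (hz i)]
          exact hi₀ i
        have h2 := mul_le_mul_of_nonneg_left h1 (inv_nonneg.2 htpos.le)
        linarith
    have := hmax hmem
    simp only [Set.mem_ofPred_eq] at this
    linarith
  refine ⟨r, x, fun i => ?_, heq⟩
  have hpow : ∀ k : ℕ, (K ^ k) *ᵥ x = r ^ k • x := by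
    intro k
    induction k with
    | zero => simp
    | succ k ih =>
      rw [pow_succ, ← Matrix.mulVec_mulVec, heq, Matrix.mulVec_smul, ih, smul_smul, pow_succ,
        mul_comm]
  have hPx : P *ᵥ x = (∑ k ∈ Finset.range N, r ^ k) • x := by
    rw [hPdef, Matrix.sum_mulVec, Finset.sum_smul]
    exact Finset.sum_congr rfl fun k _ => hpow k
  have h := hz i
  rw [hPx, Pi.smul_apply, smul_eq_mul] at h
  exact lt_of_le_of_ne (hx.1 i) fun h0 => by rw [← h0, mul_zero] at h; exact lt_irrefl _ h

/-- Perron–Frobenius for a symmetric operator that acts on a possibly non-orthogonal, possibly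
dependent system of vectors of `S` through an irreducible nonnegative matrix. If the system
separates the points of `S` and none of its combinations with positive coefficients vanishes, then
the largest eigenvalue on `S` is nondegenerate. -/
theorem exists_smul_eq_of_irreducible {ι V : Type*} [Fintype ι] [DecidableEq ι] [Nonempty ι]
    [NormedAddCommGroup V] [InnerProductSpace ℂ V] {T : V →ₗ[ℂ] V} {S : Submodule ℂ V}
    {ψ : ι → V} {K : Matrix ι ι ℝ} (hK : ∀ i j, 0 ≤ K i j)
    (hirr : ∀ i j, ∃ k : ℕ, 0 < (K ^ k) i j) (hψS : ∀ i, ψ i ∈ S)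
    (hT : ∀ v w, inner ℂ (T v) w = inner ℂ v (T w))
    (hTψ : ∀ i, T (ψ i) = ∑ j, (K j i : ℂ) • ψ j)
    (hsep : ∀ v ∈ S, (∀ i, inner ℂ (ψ i) v = 0) → v = 0)
    (hpos : ∀ c : ι → ℝ, (∀ i, 0 < c i) → ∑ i, (c i : ℂ) • ψ i ≠ 0)
    {μ : ℝ} (hmax : ∀ ν : ℝ, ∀ v ∈ S, v ≠ 0 → T v = (ν : ℂ) • v → ν ≤ μ)
    {v w : V} (hv : v ∈ S) (hw : w ∈ S) (hTv : T v = (μ : ℂ) • v) (hTw : T w = (μ : ℂ) • w)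
    (hv0 : v ≠ 0) : ∃ z : ℂ, w = z • v := by
  obtain ⟨r, c, hc, hKc⟩ := exists_pos_eigenvector hK hirr
  have hrμ : r ≤ μ := by
    refine hmax r _ (S.sum_mem fun i _ => S.smul_mem (c i : ℂ) (hψS i)) (hpos c hc) ?_
    simp only [map_sum, map_smul, hTψ, Finset.smul_sum, smul_smul]
    rw [Finset.sum_comm]
    refine Finset.sum_congr rfl fun j _ => ?_
    rw [← Finset.sum_smul]
    congr 1
    have := congrFun hKc j
    simp only [Matrix.mulVec, dotProduct, Pi.smul_apply, smul_eq_mul] at this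
    rw [← Complex.ofReal_mul, ← this]
    push_cast
    exact Finset.sum_congr rfl fun i _ => mul_comm _ _
  -- A top eigenvector with one vanishing coefficient vanishes.
  have key : ∀ u ∈ S, T u = (μ : ℂ) • u → ∀ i, inner ℂ (ψ i) u = 0 → u = 0 := by
    intro u hu hTu i₀ hi₀
    set f : ι → ℝ := fun i => ‖inner ℂ (ψ i) u‖ with hf
    have hle : ∀ i, μ * f i ≤ ∑ j, K j i * f j := by
      intro i
      have h1 : (μ : ℂ) * inner ℂ (ψ i) u = ∑ j, (K j i : ℂ) * inner ℂ (ψ j) u := by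
        rw [← inner_smul_right, ← hTu, ← hT, hTψ, sum_inner]
        refine Finset.sum_congr rfl fun j _ => ?_
        rw [inner_smul_left, Complex.conj_ofReal]
      calc μ * f i ≤ |μ| * f i := mul_le_mul_of_nonneg_right (le_abs_self μ) (norm_nonneg _)
        _ = ‖(μ : ℂ) * inner ℂ (ψ i) u‖ := by rw [norm_mul, Complex.norm_real, Real.norm_eq_abs]
        _ ≤ ∑ j, ‖(K j i : ℂ) * inner ℂ (ψ j) u‖ := by rw [h1]; exact norm_sum_le _ _
        _ = ∑ j, K j i * f j := by
          refine Finset.sum_congr rfl fun j _ => ?_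
          rw [norm_mul, Complex.norm_real, Real.norm_eq_abs, abs_of_nonneg (hK j i)]
    have hle' : ∀ i ∈ Finset.univ, c i * (μ * f i) ≤ c i * ∑ j, K j i * f j :=
      fun i _ => mul_le_mul_of_nonneg_left (hle i) (hc i).le
    have hsum : ∑ i, c i * ∑ j, K j i * f j = ∑ j, r * c j * f j := by
      simp only [Finset.mul_sum]
      rw [Finset.sum_comm]
      refine Finset.sum_congr rfl fun j _ => ?_
      have := congrFun hKc j
      simp only [Matrix.mulVec, dotProduct, Pi.smul_apply, smul_eq_mul] at this
      rw [← this, Finset.sum_mul]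
      exact Finset.sum_congr rfl fun i _ => by ring
    -- Pairing with the Perron vector forces equality in the triangle inequalities.
    have hge : ∑ i, c i * ∑ j, K j i * f j ≤ ∑ i, c i * (μ * f i) := by
      rw [hsum]
      refine Finset.sum_le_sum fun j _ => ?_
      have := mul_le_mul_of_nonneg_right hrμ (mul_nonneg (hc j).le (norm_nonneg _ : 0 ≤ f j))
      linarith
    have heq := (Finset.sum_eq_sum_iff_of_le hle').1 (le_antisymm (Finset.sum_le_sum hle') hge)
    have hvec : f ᵥ* K = μ • f := by
      ext i
      have := mul_left_cancel₀ (hc i).ne' (heq i (Finset.mem_univ i))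
      simp only [Matrix.vecMul, dotProduct, Pi.smul_apply, smul_eq_mul]
      rw [this]
      exact Finset.sum_congr rfl fun j _ => mul_comm _ _
    have hvecpow : ∀ k : ℕ, f ᵥ* (K ^ k) = μ ^ k • f := by
      intro k
      induction k with
      | zero => simp
      | succ k ih =>
        rw [pow_succ, ← Matrix.vecMul_vecMul, ih, Matrix.smul_vecMul, hvec, smul_smul, pow_succ]
    refine hsep u hu fun j => ?_
    obtain ⟨k, hk⟩ := hirr j i₀
    have h0 := congrFun (hvecpow k) i₀
    have hfi : f i₀ = 0 := by simp [hf, hi₀]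
    rw [Pi.smul_apply, hfi, smul_zero] at h0
    have hnn : ∀ l ∈ Finset.univ, 0 ≤ f l * (K ^ k) l i₀ := fun l _ =>
      mul_nonneg (norm_nonneg _) (matrix_pow_nonneg hK k l i₀)
    have h1 := (Finset.sum_eq_zero_iff_of_nonneg hnn).1 h0 j (Finset.mem_univ j)
    exact norm_eq_zero.1 ((mul_eq_zero.1 h1).resolve_right hk.ne')
  obtain ⟨i⟩ := ‹Nonempty ι›
  have hvi : inner ℂ (ψ i) v ≠ 0 := fun h => hv0 (key v hv hTv i h)
  refine ⟨inner ℂ (ψ i) w / inner ℂ (ψ i) v, sub_eq_zero.1 (key _ ?_ ?_ i ?_)⟩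
  · exact S.sub_mem hw (S.smul_mem _ hv)
  · rw [map_sub, map_smul, hTv, hTw, smul_sub, smul_comm]
  · rw [inner_sub_right, inner_smul_right, div_mul_cancel₀ _ hvi, sub_self]

/-! ### Reachable permutations and spanning of the singlet sector -/

/-- `τ` arises from `σ` by reconnecting the valence bonds along one bond of the ring. -/
def SurgeryStep {n : ℕ} (σ τ : Equiv.Perm (Fin n)) : Prop :=
  ∃ b, τ = surgery σ (ringBond b).1 (ringBond b).2

/-- The permutations that arise from the identity, that is, from the state in which all dimers
are singlets, by reconnections along bonds of the ring. -/
def Reachable {n : ℕ} (σ : Equiv.Perm (Fin n)) : Prop :=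
  Relation.ReflTransGen SurgeryStep 1 σ

theorem Reachable.surgery {n : ℕ} {σ : Equiv.Perm (Fin n)} (h : Reachable σ)
    (b : Fin n ⊕ Fin n) : Reachable (surgery σ (ringBond b).1 (ringBond b).2) :=
  Relation.ReflTransGen.tail h ⟨b, rfl⟩

/-- Reconnecting along all dimers leads from any permutation to the identity. -/
theorem reflTransGen_surgeryStep_one {n : ℕ} (σ : Equiv.Perm (Fin n)) :
    Relation.ReflTransGen SurgeryStep σ 1 := by
  have h : ∀ A : Finset (Fin n), ∃ τ, Relation.ReflTransGen SurgeryStep σ τ ∧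
      ∀ k ∈ A, τ k = k := by
    intro A
    induction A using Finset.induction_on with
    | empty => exact ⟨σ, Relation.ReflTransGen.refl, by simp⟩
    | insert k A hk ih =>
      obtain ⟨τ, h1, h2⟩ := ih
      refine ⟨SpinRing.surgery τ k k, h1.tail ⟨Sum.inl k, rfl⟩, fun l hl => ?_⟩
      by_cases hlk : l = k
      · rw [hlk, surgery_apply_self]
      · have hl' := h2 l ((Finset.mem_insert.1 hl).resolve_left hlk)
        rw [surgery_apply_of_ne τ hlk (by rw [hl']; exact hlk), hl']
  obtain ⟨τ, h1, h2⟩ := h Finset.univ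
  have : τ = 1 := Equiv.ext fun k => h2 k (Finset.mem_univ k)
  exact this ▸ h1

/-- A state in which all dimers are singlets is a multiple of the corresponding product state. -/
theorem eq_smul_valenceBond_one {n : ℕ} {v : HilbertSpace (n * 2)}
    (h : ∀ k, bondOp (n * 2) (leftSite k) (rightSite k) v = v) :
    ∃ z : ℂ, v = z • valenceBond 1 := by
  have hpair : ∀ (k : Fin n) (t : Fin (n * 2) → Fin 2), v t =
      singletAmp (t (leftSite k)) (t (rightSite k)) *
        v (Function.update (Function.update t (leftSite k) 0) (rightSite k) 1) := by
    intro k t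
    have hne := leftSite_ne_rightSite k k
    have h1 := (bondOp_eq_self_iff hne v).1 (h k) t
    have h0 := comp_swap_eq_update (leftSite k) (rightSite k) t
    by_cases heq : t (leftSite k) = t (rightSite k)
    · rw [comp_swap_eq_self heq] at h1
      rw [singletAmp, if_pos heq, zero_mul]
      linear_combination (1 / 2 : ℂ) * h1
    · rw [singletAmp, if_neg heq]
      split_ifs with h2
      · have h3 : t (rightSite k) = 1 := by
          rw [h2] at heq
          exact Fin.eq_one_of_ne_zero _ (Ne.symm heq)
        have h4 : Function.update (Function.update t (leftSite k) 0) (rightSite k) 1 = t := by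
          rw [← h2, Function.update_eq_self, ← h3, Function.update_eq_self]
        rw [h4, one_mul]
      · have h2' := Fin.eq_one_of_ne_zero _ h2
        have h3 : t (rightSite k) = 0 := by
          by_contra hc
          exact heq (h2'.trans (Fin.eq_one_of_ne_zero _ hc).symm)
        rw [h3, h2'] at h0
        rw [← h0, h1]
        ring
  -- The dimers are brought to the configuration `↑↓` one after the other.
  set ref : Fin (n * 2) → Fin 2 := fun α => α.modNat with href
  have key : ∀ (A : Finset (Fin n)) (s : Fin (n * 2) → Fin 2), v s =
      (∏ k ∈ A, singletAmp (s (leftSite k)) (s (rightSite k))) *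
        v (fun α => if α.divNat ∈ A then ref α else s α) := by
    intro A s
    induction A using Finset.induction_on with
    | empty => simp
    | insert k A hk ih =>
      have hdl : ∀ k : Fin n, (leftSite k).divNat = k := by
        intro k; ext; simp [leftSite, Fin.divNat]
      have hdr : ∀ k : Fin n, (rightSite k).divNat = k := by
        intro k; ext; simp [rightSite, Fin.divNat]; omega
      rw [ih, Finset.prod_insert hk, hpair k]
      simp only [hdl, hdr, hk, if_false]
      have hfun : Function.update (Function.update
          (fun α => if α.divNat ∈ A then ref α else s α) (leftSite k) 0) (rightSite k) 1 =
          fun α => if α.divNat ∈ insert k A then ref α else s α := by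
        ext1 α
        by_cases h1 : α = rightSite k
        · subst h1
          rw [Function.update_self, if_pos (by rw [hdr]; exact Finset.mem_insert_self k A)]
          simp [href, rightSite, Fin.modNat]
        · rw [Function.update_of_ne h1]
          by_cases h2 : α = leftSite k
          · subst h2
            rw [Function.update_self, if_pos (by rw [hdl]; exact Finset.mem_insert_self k A)]
            simp [href, leftSite, Fin.modNat]
          · rw [Function.update_of_ne h2]
            have : α.divNat ≠ k := by
              intro hc
              have hc' := congrArg Fin.val hc
              simp only [Fin.divNat] at hc'
              simp only [leftSite, rightSite, Fin.ext_iff] at h1 h2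
              omega
            simp [this]
      rw [hfun]
      ring
  refine ⟨v ref, ?_⟩
  ext1 s
  rw [key Finset.univ s, PiLp.smul_apply, valenceBond_apply]
  simp [mul_comm]

/-- The valence bond states of the reachable permutations span the singlet sector: a singlet
orthogonal to all of them vanishes. -/
theorem eq_zero_of_inner_valenceBond {n : ℕ} {v : HilbertSpace (n * 2)}
    (hv : v ∈ spinSector (n * 2) 0)
    (h : ∀ σ, Reachable σ → inner ℂ (valenceBond σ) v = 0) : v = 0 := by
  let N : Submodule ℂ (HilbertSpace (n * 2)) :=
    spinSector (n * 2) 0 ⊓ (Submodule.span ℂ (valenceBond '' {σ | Reachable σ}))ᗮ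
  have hmem : ∀ w, w ∈ N ↔ w ∈ spinSector (n * 2) 0 ∧
      ∀ σ, Reachable σ → inner ℂ (valenceBond σ) w = 0 := by
    intro w
    refine and_congr Iff.rfl ⟨fun hw σ hσ => ?_, fun hw => ?_⟩
    · exact hw _ (Submodule.subset_span ⟨σ, hσ, rfl⟩)
    · intro u hu
      induction hu using Submodule.span_induction with
      | mem x hx => obtain ⟨σ, hσ, rfl⟩ := hx; exact hw σ hσ
      | zero => simp
      | add x y _ _ hx hy => rw [inner_add_left, hx, hy, add_zero]
      | smul a x _ hx => rw [inner_smul_left, hx, mul_zero]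
  have hring : ∀ (b : Fin n ⊕ Fin n), ∀ w ∈ N,
      bondOp (n * 2) (leftSite (ringBond b).1) (rightSite (ringBond b).2) w ∈ N := by
    intro b w hw
    rw [hmem] at hw ⊢
    refine ⟨bondOp_mem_singletSector (leftSite_ne_rightSite _ _) hw.1, fun σ hσ => ?_⟩
    rw [← inner_bondOp_left]
    by_cases hb : σ (ringBond b).1 = (ringBond b).2
    · rw [bondOp_valenceBond_of_eq hb, hw.2 σ hσ]
    · rw [bondOp_valenceBond_of_ne hb, inner_smul_left, hw.2 _ (hσ.surgery b), mul_zero]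
  refine eq_zero_of_invariant N ?_ ?_ ?_ ((hmem v).2 ⟨hv, h⟩)
  · intro α β hαβ w hw
    obtain ⟨k, hk | hk⟩ : ∃ k : ℕ, (α : ℕ) = 2 * k ∨ (α : ℕ) = 2 * k + 1 :=
      ⟨α / 2, by omega⟩
    · have h1 : α = leftSite ⟨k, by omega⟩ := Fin.ext hk
      have h2 : β = rightSite ⟨k, by omega⟩ := Fin.ext (by simp only [rightSite]; omega)
      have := hring (Sum.inl ⟨k, by omega⟩) w hw
      rwa [ringBond, ← h1, ← h2] at this
    · have h1 : α = rightSite ⟨k, by omega⟩ := Fin.ext hk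
      have h2 : β = leftSite (finRotate n ⟨k, by omega⟩) := by
        ext
        simp only [leftSite, coe_finRotate_eq_mod]
        rw [Nat.mod_eq_of_lt (by omega)]
        omega
      have := hring (Sum.inr ⟨k, by omega⟩) w hw
      rwa [ringBond, ← h1, ← h2, bondOp_comm] at this
  · intro w hw
    exact mem_singletSector_iff.1 hw.1
  · intro w hw hd
    obtain ⟨z, rfl⟩ := eq_smul_valenceBond_one hd
    have h0 := ((hmem _).1 hw).2 1 Relation.ReflTransGen.refl
    rw [inner_smul_right] at h0
    rcases mul_eq_zero.1 h0 with h1 | h1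
    · rw [h1, zero_smul]
    · rw [inner_self_eq_zero.1 h1, smul_zero]

/-! ### Noncrossing configurations -/

/-- The valence bond of the dimer `k` separates the site `α` from the outside. -/
def Encloses {n : ℕ} (σ : Equiv.Perm (Fin n)) (k : Fin n) (α : ℕ) : Prop :=
  (2 * (k : ℕ) < α ∧ α < 2 * (σ k : ℕ) + 1) ∨ (2 * (σ k : ℕ) + 1 < α ∧ α < 2 * (k : ℕ))

/-- The valence bonds of `σ` can be drawn in the disk without crossings: no bond separates the
end points of another one. -/
def Noncrossing {n : ℕ} (σ : Equiv.Perm (Fin n)) : Prop :=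
  ∀ k l, k ≠ l → (Encloses σ k (2 * l) ↔ Encloses σ k (2 * σ l + 1))

theorem noncrossing_one {n : ℕ} : Noncrossing (1 : Equiv.Perm (Fin n)) := by
  intro k l hkl
  have : (k : ℕ) ≠ l := Fin.val_ne_of_ne hkl
  simp only [Encloses, Equiv.Perm.one_apply]
  omega

theorem Noncrossing.surgery {n : ℕ} {σ : Equiv.Perm (Fin n)} (h : Noncrossing σ)
    (b : Fin n ⊕ Fin n) : Noncrossing (surgery σ (ringBond b).1 (ringBond b).2) := by
  have hadj : ((ringBond b).1 : ℕ) = (ringBond b).2 ∨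
      ((ringBond b).1 : ℕ) = (ringBond b).2 + 1 ∨
      (((ringBond b).1 : ℕ) = 0 ∧ ((ringBond b).2 : ℕ) + 1 = n) := by
    rcases b with k | k
    · exact Or.inl rfl
    · right
      simp only [ringBond, coe_finRotate_eq_mod]
      rcases Nat.lt_or_ge (k + 1) n with hk | hk
      · left; exact Nat.mod_eq_of_lt hk
      · right
        have : (k : ℕ) + 1 = n := by omega
        exact ⟨by rw [this, Nat.mod_self], this⟩
  generalize (ringBond b).1 = k at *
  generalize (ringBond b).2 = l at *
  obtain ⟨m, rfl⟩ := σ.surjective l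
  by_cases hmk : m = k
  · rwa [surgery_of_eq (by rw [hmk])]
  have hk : SpinRing.surgery σ k (σ m) k = σ m := surgery_apply_self _ _ _
  have hm : SpinRing.surgery σ k (σ m) m = σ k := by
    simpa using surgery_apply_symm σ k (σ m)
  have ho : ∀ i, i ≠ k → i ≠ m → SpinRing.surgery σ k (σ m) i = σ i := fun i h1 h2 =>
    surgery_apply_of_ne σ h1 (σ.injective.ne h2)
  have hv : ∀ i j : Fin n, i ≠ j → (i : ℕ) ≠ j ∧ (σ i : ℕ) ≠ σ j := fun i j hij =>
    ⟨Fin.val_ne_of_ne hij, Fin.val_ne_of_ne (σ.injective.ne hij)⟩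
  intro p q hpq
  have hpq' := hv p q hpq
  have hmk' := hv m k hmk
  have hkn := k.isLt
  have hqn := q.isLt
  have hsq := (σ q).isLt
  have hsk := (σ k).isLt
  by_cases hpk : p = k
  · subst hpk
    by_cases hqm : q = m
    · subst hqm
      simp only [Encloses, hk, hm]
      omega
    · have := hv q m hqm
      simp only [Encloses, hk, ho q hpq.symm hqm]
      omega
  · have hpk' := hv p k hpk
    by_cases hpm : p = m
    · subst hpm
      by_cases hqk : q = k
      · subst hqk
        simp only [Encloses, hk, hm]
        omega
      · have h1 := h q k hqk
        have h2 := h q p hpq.symm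
        have := hv q k hqk
        simp only [Encloses, hm, ho q hqk hpq.symm] at h1 h2 ⊢
        omega
    · have hpm' := hv p m hpm
      by_cases hqk : q = k
      · subst hqk
        simp only [Encloses, hk, ho p hpk hpm]
        omega
      · by_cases hqm : q = m
        · subst hqm
          have h1 := h p k hpk
          have h2 := h p q hpm
          simp only [Encloses, hm, ho p hpk hpm] at h1 h2 ⊢
          omega
        · have h1 := h p q hpq
          simp only [Encloses, ho p hpk hpm, ho q hqk hqm] at h1 ⊢
          exact h1

theorem Reachable.noncrossing {n : ℕ} {σ : Equiv.Perm (Fin n)} (h : Reachable σ) :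
    Noncrossing σ := by
  induction h with
  | refl => exact noncrossing_one
  | tail _ hstep ih =>
    obtain ⟨b, rfl⟩ := hstep
    exact ih.surgery b

/-- The configuration with the first half of the spins up and the second half down. -/
def domainWall (n : ℕ) : Fin (n * 2) → Fin 2 := fun α => if (α : ℕ) < n then 0 else 1

theorem valenceBond_domainWall_ne_zero_iff {n : ℕ} {σ : Equiv.Perm (Fin n)} :
    valenceBond σ (domainWall n) ≠ 0 ↔ ∀ k : Fin n, 2 * (k : ℕ) < n ↔ n ≤ 2 * (σ k : ℕ) + 1 := by
  rw [valenceBond_apply, mul_ne_zero_iff, Finset.prod_ne_zero_iff]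
  have h1 : ((Equiv.Perm.sign σ : ℤ) : ℂ) ≠ 0 := by
    rw [Int.cast_ne_zero]; exact Units.ne_zero _
  simp only [h1, ne_eq, not_false_eq_true, true_and, Finset.mem_univ, forall_true_left]
  refine forall_congr' fun k => ?_
  by_cases h2 : 2 * (k : ℕ) < n <;> by_cases h3 : 2 * (σ k : ℕ) + 1 < n <;>
    (simp [singletAmp, domainWall, leftSite, rightSite, h2, h3]; try omega)

/-- Noncrossing valence bonds that all join the first half of the ring with the second half are
nested, so that there is only one such configuration. -/
theorem Noncrossing.eq_revPerm {n : ℕ} {σ : Equiv.Perm (Fin n)} (h : Noncrossing σ)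
    (hσ : valenceBond σ (domainWall n) ≠ 0) : σ = Fin.revPerm := by
  rw [valenceBond_domainWall_ne_zero_iff] at hσ
  -- `u k` is the end point in the first half, `w k` the mirror image of the other end point.
  let u : Fin n → Fin n := fun k =>
    ⟨if 2 * (k : ℕ) < n then 2 * k else 2 * σ k + 1, by have := hσ k; split_ifs <;> omega⟩
  let w : Fin n → Fin n := fun k =>
    ⟨if 2 * (k : ℕ) < n then 2 * n - 1 - (2 * σ k + 1) else 2 * n - 1 - 2 * k, by
      have := hσ k; have := k.isLt; split_ifs <;> omega⟩
  have hinj : Function.Injective u := by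
    intro k l hkl
    have h1 := congrArg Fin.val hkl
    simp only [u] at h1
    split_ifs at h1
    · exact Fin.ext (by omega)
    · omega
    · omega
    · exact σ.injective (Fin.ext (by omega))
  let e : Fin n ≃ Fin n := Equiv.ofBijective u (Finite.injective_iff_bijective.1 hinj)
  have hmono : ∀ k l, u k < u l → w k < w l := by
    intro k l hkl
    have hne : k ≠ l := by rintro rfl; exact lt_irrefl _ hkl
    have h1 := h k l hne
    have h2 := h l k hne.symm
    have h3 := hσ k
    have h4 := hσ l
    have h5 := (σ k).isLt
    have h6 := (σ l).isLt
    simp only [Encloses] at h1 h2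
    rw [Fin.lt_def] at hkl ⊢
    simp only [u] at hkl
    simp only [w]
    split_ifs at hkl ⊢ <;> omega
  have hstrict : StrictMono (w ∘ e.symm) := by
    intro i j hij
    refine hmono _ _ ?_
    have hu : ∀ i, u (e.symm i) = i := fun i => e.apply_symm_apply i
    rwa [hu, hu]
  have hid : w ∘ e.symm = id := by
    refine (StrictMono.range_inj hstrict strictMono_id).1 ?_
    rw [Set.range_id]
    exact Set.range_eq_univ.2 (Finite.injective_iff_surjective.1 hstrict.injective)
  have huw : ∀ k, w k = u k := by
    intro k
    have := congrFun hid (e k)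
    rw [Function.comp_apply, e.symm_apply_apply] at this
    exact this
  ext k
  have h1 := congrArg Fin.val (huw k)
  have h2 := (σ k).isLt
  simp only [u, w] at h1
  rw [Fin.revPerm_apply, Fin.val_rev]
  split_ifs at h1 <;> omega

theorem valenceBond_revPerm_domainWall (n : ℕ) :
    valenceBond (Fin.revPerm : Equiv.Perm (Fin n)) (domainWall n) ≠ 0 := by
  rw [valenceBond_domainWall_ne_zero_iff]
  intro k
  rw [Fin.revPerm_apply, Fin.val_rev]
  omega

/-- The nested configuration is reachable: its valence bond state is a combination of the reachable
ones, so one of these has a domain wall component, which forces it to be nested. -/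
theorem reachable_revPerm (n : ℕ) : Reachable (Fin.revPerm : Equiv.Perm (Fin n)) := by
  by_contra hrev
  have hzero : ∀ σ : Equiv.Perm (Fin n), Reachable σ → valenceBond σ (domainWall n) = 0 := by
    intro σ hσ
    by_contra h
    exact hrev (hσ.noncrossing.eq_revPerm h ▸ hσ)
  set W := Submodule.span ℂ (valenceBond '' {σ : Equiv.Perm (Fin n) | Reachable σ}) with hW
  have hWsing : W ≤ spinSector (n * 2) 0 := by
    rw [hW, Submodule.span_le]
    rintro _ ⟨σ, _, rfl⟩
    exact mem_singletSector_iff.2 (casimir_valenceBond σ)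
  have hWzero : ∀ v ∈ W, v (domainWall n) = 0 := by
    intro v hv
    induction hv using Submodule.span_induction with
    | mem x hx => obtain ⟨σ, hσ, rfl⟩ := hx; exact hzero σ hσ
    | zero => rfl
    | add x y _ _ hx hy => rw [PiLp.add_apply, hx, hy, add_zero]
    | smul a x _ hx => rw [PiLp.smul_apply, hx, smul_zero]
  obtain ⟨y, hy, z, hz, hyz⟩ :=
    W.exists_add_mem_mem_orthogonal (valenceBond (Fin.revPerm : Equiv.Perm (Fin n)))
  have hz0 : z = 0 := by
    refine eq_zero_of_inner_valenceBond ?_ fun σ hσ => hz _ (Submodule.subset_span ⟨σ, hσ, rfl⟩)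
    rw [← sub_eq_of_eq_add' hyz]
    exact Submodule.sub_mem _ (mem_singletSector_iff.2 (casimir_valenceBond _)) (hWsing hy)
  refine valenceBond_revPerm_domainWall n ?_
  rw [hyz, hz0, add_zero]
  exact hWzero y hy

/-! ### Nondegeneracy of the singlet ground state -/

theorem inner_hamiltonian_left {L : ℕ} (v w : HilbertSpace L) :
    inner ℂ (hamiltonian L v) w = inner ℂ v (hamiltonian L w) := by
  simp only [hamiltonian, sum_apply, sum_inner, inner_sum, inner_bondOp_left]

theorem energyMin_le {L S : ℕ} {v : HilbertSpace L} (hv : v ∈ spinSector L S) (hv0 : v ≠ 0)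
    {E : ℝ} (hE : hamiltonian L v = (E : ℂ) • v) : energyMin S L ≤ E := by
  refine csInf_le ⟨-‖hamiltonian L‖, ?_⟩ ⟨v, hv, hv0, ?_⟩
  · rintro r ⟨ψ, -, hψ, rfl⟩
    have hpos : 0 < ‖ψ‖ ^ 2 := by positivity
    rw [le_div_iff₀ hpos]
    have h1 : ‖inner ℂ ψ (hamiltonian L ψ)‖ ≤ ‖ψ‖ * (‖hamiltonian L‖ * ‖ψ‖) :=
      (norm_inner_le_norm _ _).trans
        (mul_le_mul_of_nonneg_left ((hamiltonian L).le_opNorm ψ) (norm_nonneg _))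
    have h2 := (Complex.abs_re_le_norm (inner ℂ ψ (hamiltonian L ψ))).trans h1
    have h3 := (abs_le.1 h2).1
    linarith
  · have hpos : ‖v‖ ^ 2 ≠ 0 := by positivity
    rw [hE, inner_smul_right, eq_div_iff hpos, Complex.re_ofReal_mul]
    exact congrArg (E * ·) (inner_self_eq_norm_sq (𝕜 := ℂ) v).symm

noncomputable instance reachableFintype {n : ℕ} :
    Fintype {σ : Equiv.Perm (Fin n) // Reachable σ} := Fintype.ofFinite _

/-- The matrix of `(2 n + 1) - H` in the reachable valence bond states; the constant exceeds the
number `2 n` of bonds so that all diagonal entries are positive. The states need not be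
independent, and the entries are those of `sub_hamiltonian_valenceBond`. -/
noncomputable def valenceBondMatrix (n : ℕ) : Matrix {σ : Equiv.Perm (Fin n) // Reachable σ}
    {σ : Equiv.Perm (Fin n) // Reachable σ} ℝ :=
  Matrix.of fun τ σ => (if τ = σ then 1 else 0) + ∑ b : Fin n ⊕ Fin n,
    if σ.1 (ringBond b).1 = (ringBond b).2 then 0 else
      (if τ = σ then 1 else 0) + 1 / 2 * if τ = ⟨_, σ.2.surgery b⟩ then 1 else 0

theorem valenceBondMatrix_term_nonneg {n : ℕ} (τ σ : {σ : Equiv.Perm (Fin n) // Reachable σ})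
    (b : Fin n ⊕ Fin n) : (0 : ℝ) ≤ if σ.1 (ringBond b).1 = (ringBond b).2 then 0 else
      (if τ = σ then 1 else 0) + 1 / 2 * if τ = ⟨_, σ.2.surgery b⟩ then 1 else 0 := by
  split_ifs <;> norm_num

theorem valenceBondMatrix_nonneg {n : ℕ} (τ σ : {σ : Equiv.Perm (Fin n) // Reachable σ}) :
    0 ≤ valenceBondMatrix n τ σ := by
  refine add_nonneg (by split_ifs <;> norm_num) (Finset.sum_nonneg fun b _ => ?_)
  exact valenceBondMatrix_term_nonneg τ σ b

theorem valenceBondMatrix_surgery_pos {n : ℕ} (σ : {σ : Equiv.Perm (Fin n) // Reachable σ})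
    (b : Fin n ⊕ Fin n) : 0 < valenceBondMatrix n ⟨_, σ.2.surgery b⟩ σ := by
  by_cases h : σ.1 (ringBond b).1 = (ringBond b).2
  · refine add_pos_of_pos_of_nonneg ?_
      (Finset.sum_nonneg fun b' _ => valenceBondMatrix_term_nonneg _ σ b')
    rw [if_pos (Subtype.ext (surgery_of_eq h))]
    exact one_pos
  · refine add_pos_of_nonneg_of_pos (by split_ifs <;> norm_num) ?_
    refine Finset.sum_pos' (fun b' _ => valenceBondMatrix_term_nonneg _ σ b')
      ⟨b, Finset.mem_univ b, ?_⟩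
    rw [if_neg h, if_pos rfl]
    split_ifs <;> norm_num

theorem exists_valenceBondMatrix_pow_pos {n : ℕ}
    (τ σ : {σ : Equiv.Perm (Fin n) // Reachable σ}) :
    ∃ k : ℕ, 0 < (valenceBondMatrix n ^ k) τ σ := by
  have h : ∀ ρ, Relation.ReflTransGen SurgeryStep σ.1 ρ → ∀ hρ : Reachable ρ,
      ∃ k : ℕ, 0 < (valenceBondMatrix n ^ k) ⟨ρ, hρ⟩ σ := by
    intro ρ hρ
    induction hρ with
    | refl => exact fun _ => ⟨0, by simp⟩
    | @tail ρ₁ ρ₂ h1 h2 ih =>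
      intro hρ₂
      have hρ₁ : Reachable ρ₁ := σ.2.trans h1
      obtain ⟨k, hk⟩ := ih hρ₁
      obtain ⟨b, rfl⟩ := h2
      refine ⟨k + 1, ?_⟩
      rw [pow_succ', Matrix.mul_apply]
      exact Finset.sum_pos' (fun ρ _ => mul_nonneg (valenceBondMatrix_nonneg _ _)
        (matrix_pow_nonneg valenceBondMatrix_nonneg k ρ σ))
        ⟨⟨ρ₁, hρ₁⟩, Finset.mem_univ _, mul_pos (valenceBondMatrix_surgery_pos ⟨ρ₁, hρ₁⟩ b) hk⟩
  exact h τ.1 ((reflTransGen_surgeryStep_one σ.1).trans τ.2) τ.2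

theorem sub_hamiltonian_valenceBond_eq_sum {n : ℕ}
    (σ : {σ : Equiv.Perm (Fin n) // Reachable σ}) :
    (2 * n + 1 : ℂ) • valenceBond σ.1 - hamiltonian (n * 2) (valenceBond σ.1) =
      ∑ τ, (valenceBondMatrix n τ σ : ℂ) • valenceBond τ.1 := by
  have hsum : ∀ ρ : {σ : Equiv.Perm (Fin n) // Reachable σ},
      ∑ τ : {σ : Equiv.Perm (Fin n) // Reachable σ},
        ((if τ = ρ then (1 : ℝ) else 0 : ℝ) : ℂ) • valenceBond τ.1 = valenceBond ρ.1 := by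
    intro ρ
    simp
  rw [sub_hamiltonian_valenceBond]
  simp only [valenceBondMatrix, Matrix.of_apply, Complex.ofReal_add, Complex.ofReal_sum, add_smul,
    Finset.sum_add_distrib, hsum, Finset.sum_smul]
  congr 1
  rw [Finset.sum_comm]
  refine Finset.sum_congr rfl fun b _ => ?_
  split_ifs with h
  · simp
  · simp only [Complex.ofReal_add, Complex.ofReal_mul, add_smul, Finset.sum_add_distrib, hsum,
      mul_smul, ← Finset.smul_sum]
    norm_num

/-- The ground state in the singlet sector is nondegenerate. -/
theorem singletGroundState_unique {n : ℕ} {v w : HilbertSpace (n * 2)}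
    (hv : IsSingletGroundState (n * 2) v) (hw : w ∈ spinSector (n * 2) 0)
    (hHw : hamiltonian (n * 2) w = (energyMin 0 (n * 2) : ℂ) • w) : ∃ z : ℂ, w = z • v := by
  classical
  have : Nonempty {σ : Equiv.Perm (Fin n) // Reachable σ} := ⟨⟨1, Relation.ReflTransGen.refl⟩⟩
  let T : HilbertSpace (n * 2) →ₗ[ℂ] HilbertSpace (n * 2) :=
    (2 * n + 1 : ℂ) • LinearMap.id - (hamiltonian (n * 2)).toLinearMap
  have hT : ∀ u, T u = (2 * n + 1 : ℂ) • u - hamiltonian (n * 2) u := fun u => rfl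
  have hTE : ∀ u, hamiltonian (n * 2) u = (energyMin 0 (n * 2) : ℂ) • u →
      T u = ((2 * n + 1 - energyMin 0 (n * 2) : ℝ) : ℂ) • u := by
    intro u hu
    rw [hT, hu, ← sub_smul]
    push_cast
    rfl
  refine exists_smul_eq_of_irreducible (T := T) (S := spinSector (n * 2) 0)
    (ψ := fun σ : {σ : Equiv.Perm (Fin n) // Reachable σ} => valenceBond σ.1)
    valenceBondMatrix_nonneg exists_valenceBondMatrix_pow_pos
    (fun σ => mem_singletSector_iff.2 (casimir_valenceBond σ.1)) ?_
    sub_hamiltonian_valenceBond_eq_sum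
    (fun u hu h => eq_zero_of_inner_valenceBond hu fun σ hσ => h ⟨σ, hσ⟩) ?_ ?_
    hv.mem_sector hw (hTE v hv.eigen) (hTE w hHw) hv.ne_zero
  · intro u u'
    rw [hT, hT, inner_sub_left, inner_sub_right, inner_smul_left, inner_smul_right,
      inner_hamiltonian_left]
    simp [Complex.conj_ofNat]
  · -- At the domain wall only the nested valence bond state contributes.
    intro c hc h0
    have h1 := congrArg (fun u : HilbertSpace (n * 2) => u (domainWall n)) h0
    simp only [WithLp.ofLp_sum, Finset.sum_apply, PiLp.smul_apply, PiLp.zero_apply] at h1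
    rw [Finset.sum_eq_single ⟨Fin.revPerm, reachable_revPerm n⟩] at h1
    · rcases smul_eq_zero.1 h1 with h2 | h2
      · exact (hc _).ne' (Complex.ofReal_eq_zero.1 h2)
      · exact valenceBond_revPerm_domainWall n h2
    · intro σ _ hσ
      by_contra h2
      exact hσ (Subtype.ext (σ.2.noncrossing.eq_revPerm (smul_ne_zero_iff.1 h2).2))
    · intro h2
      exact absurd (Finset.mem_univ _) h2
  · intro ν u hu hu0 hTu
    have hHu : hamiltonian (n * 2) u = ((2 * n + 1 - ν : ℝ) : ℂ) • u := by
      rw [hT, sub_eq_iff_eq_add, ← sub_eq_iff_eq_add'] at hTu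
      rw [← hTu, ← sub_smul]
      push_cast
      rfl
    have := energyMin_le hu hu0 hHu
    linarith

/-! ### The double commutator -/

/-- Symmetrization of `⟨Θ, A* (H - E) A Θ⟩` for an eigenvector `Θ` of `H` and of `U`: the unitary
`U` preserves `Θ` up to a phase, and conjugation with it interchanges `A* (H - E) A` with `A (H - E) A*`. -/
theorem inner_eq_half_inner_doubleCommutator {V : Type*} [NormedAddCommGroup V]
    [InnerProductSpace ℂ V] [CompleteSpace V] {H A U : V →L[ℂ] V} {Θ : V} {E : ℝ} {z : ℂ}
    (hH : ∀ v w, inner ℂ (H v) w = inner ℂ v (H w)) (hE : H Θ = (E : ℂ) • Θ)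
    (hU : U ∈ unitary (V →L[ℂ] V)) (hA : star A = star U * A * U) (hUH : H = star U * H * U)
    (hz : U Θ = z • Θ) :
    inner ℂ Θ ((star A * (H - (E : ℂ) • (1 : V →L[ℂ] V)) * A) Θ) =
      (1 / 2 : ℂ) * inner ℂ Θ (⁅star A, ⁅H, A⁆⁆ Θ) := by
  have hU1 : star U * U = 1 := Unitary.star_mul_self_of_mem hU
  have hU2 : U * star U = 1 := Unitary.mul_star_self_of_mem hU
  set B := H - (E : ℂ) • (1 : V →L[ℂ] V) with hB
  have hBΘ : B Θ = 0 := by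
    rw [hB]
    simp [hE]
  have hBs : ∀ v, inner ℂ Θ (B v) = 0 := by
    intro v
    have : inner ℂ (B Θ) v = inner ℂ Θ (B v) := by
      simp [hB, hH]
    rw [← this, hBΘ, inner_zero_left]
  have hUHU : U * H * star U = H := by
    calc U * H * star U = U * (star U * H * U) * star U := by rw [← hUH]
      _ = (U * star U) * H * (U * star U) := by simp only [mul_assoc]
      _ = H := by rw [hU2, one_mul, mul_one]
  have hUB : U * B * star U = B := by
    rw [hB, mul_sub, sub_mul, hUHU]
    simp [hU2]
  have hA' : A = star U * star A * U := by
    have := congrArg star hA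
    simpa [mul_assoc] using this
  have hABA : A * B * star A = star U * (star A * B * A) * U := by
    calc A * B * star A = (star U * star A * U) * B * (star U * A * U) := by rw [← hA, ← hA']
      _ = star U * star A * (U * B * star U) * A * U := by simp only [mul_assoc]
      _ = star U * (star A * B * A) * U := by rw [hUB]; simp only [mul_assoc]
  have hinner : ∀ v w, inner ℂ v ((star U) w) = inner ℂ (U v) w := by
    intro v w
    rw [ContinuousLinearMap.star_eq_adjoint, ContinuousLinearMap.adjoint_inner_right]
  have hphase : inner ℂ Θ ((A * B * star A) Θ) = inner ℂ Θ ((star A * B * A) Θ) := by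
    rcases eq_or_ne Θ 0 with h0 | h0
    · rw [h0, inner_zero_left, inner_zero_left]
    have hzz : (starRingEnd ℂ) z * z = 1 := by
      have h1 : inner ℂ (U Θ) (U Θ) = inner ℂ Θ Θ := by
        rw [← hinner]
        exact congrArg (fun X : V →L[ℂ] V => inner ℂ Θ (X Θ)) hU1
      rw [hz, inner_smul_left, inner_smul_right, ← mul_assoc] at h1
      exact mul_right_cancel₀ (inner_self_ne_zero.2 h0) (h1.trans (one_mul _).symm)
    rw [hABA]
    calc inner ℂ Θ ((star U * (star A * B * A) * U) Θ)
        = inner ℂ Θ ((star U) ((star A * B * A) (U Θ))) := rfl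
      _ = (starRingEnd ℂ) z * z * inner ℂ Θ ((star A * B * A) Θ) := by
        rw [hinner, hz, map_smul, inner_smul_left, inner_smul_right, ← mul_assoc]
      _ = inner ℂ Θ ((star A * B * A) Θ) := by rw [hzz, one_mul]
  have hcomm : ⁅star A, ⁅H, A⁆⁆ =
      star A * B * A - star A * A * B - B * (A * star A) + A * B * star A := by
    have : ⁅H, A⁆ = B * A - A * B := by
      rw [Ring.lie_def, hB]
      simp [sub_mul, mul_sub]
    rw [this, Ring.lie_def]
    noncomm_ring
  have h1 : (star A * A * B) Θ = 0 := by
    change (star A * A) (B Θ) = 0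
    rw [hBΘ, map_zero]
  have h2 : inner ℂ Θ ((B * (A * star A)) Θ) = 0 := hBs _
  rw [hcomm, _root_.add_apply, _root_.sub_apply, _root_.sub_apply, inner_add_right, inner_sub_right,
    inner_sub_right, h1, h2, hphase, inner_zero_right]
  ring

end SpinRing

theorem mainTheorem2 (L : ℕ) (hL : Even L)
    (Θ : SpinRing.HilbertSpace L) (hΘ : SpinRing.IsSingletGroundState L Θ)
    (A U : SpinRing.Op L)
    (hU : U ∈ unitary (SpinRing.Op L))
    (hA : star A = star U * A * U)
    (hUH : SpinRing.hamiltonian L = star U * SpinRing.hamiltonian L * U)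
    (hUC : SpinRing.casimir L = star U * SpinRing.casimir L * U) :
    inner ℂ Θ
        ((star A *
          (SpinRing.hamiltonian L - (SpinRing.energyMin 0 L : ℂ) • (1 : SpinRing.Op L)) * A) Θ) =
      (1 / 2 : ℂ) * inner ℂ Θ (⁅star A, ⁅SpinRing.hamiltonian L, A⁆⁆ Θ) := by
  obtain ⟨n, rfl⟩ : ∃ n, L = n * 2 := by
    obtain ⟨n, hn⟩ := hL
    exact ⟨n, by omega⟩
  -- Operators fixed by the conjugation with `U` commute with `U`.
  have hcomm : ∀ X : SpinRing.Op (n * 2), X = star U * X * U → ∀ v, X (U v) = U (X v) := by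
    intro X hX v
    have h : U * X = X * U := by
      calc U * X = U * (star U * X * U) := by rw [← hX]
        _ = (U * star U) * X * U := by simp only [mul_assoc]
        _ = X * U := by rw [Unitary.mul_star_self_of_mem hU, one_mul]
    exact (congrArg (fun Y : SpinRing.Op (n * 2) => Y v) h).symm
  obtain ⟨z, hz⟩ := SpinRing.singletGroundState_unique hΘ (w := U Θ)
    (by
      rw [SpinRing.mem_singletSector_iff, hcomm _ hUC,
        SpinRing.mem_singletSector_iff.1 hΘ.mem_sector, map_zero])
    (by rw [hcomm _ hUH, hΘ.eigen, map_smul])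
  exact SpinRing.inner_eq_half_inner_doubleCommutator SpinRing.inner_hamiltonian_left hΘ.eigen
    hU hA hUH hz
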